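/- **Theorem (Lieb's variational principle).** Let $\mathfrak h$ be a complex separable Hilbert space and $N\ge 2$ an integer. Let $h$ be a densely defined symmetric operator on $\mathfrak h$ with $h+m\ge 0$ for some $m\in\mathbb R$, and let $V$ be a densely defined symmetric operator on the Hilbert space tensor product $\mathfrak h\otimes\mathfrak h$ with $\langle\psi, V\psi\rangle\ge 0$ for all $\psi$ in its domain. For such operators, $\langle x, (h+m)x\rangle$ and $\langle\psi,V\psi\rangle$ also denote the closures of the quadratic forms of $h+m$ and $V$, with the value $+\infty$ outside of the form domain, and $\langle x,hx\rangle:=\langle x,(h+m)x\rangle-m\|x\|^2$. For a bounded operator $T\ge 0$ and $A=h+m$ or $A=V$ put $\mathrm{Tr}[A\,T]:=\sum_k\langle T^{1/2}e_k, A\,T^{1/2}e_k\rangle\in[0,\infty]$ for an orthonormal basis $(e_k)$ (the sum does not depend on the basis). For a trace-class operator $\gamma\ge 0$ on $\mathfrak h$ put $\mathrm{Tr}[h\gamma]:=\mathrm{Tr}[(h+m)\gamma]-m\,\mathrm{Tr}\,\gamma$ and define the Hartree–Fock functional $$\mathcal E_{\rm HF}(\gamma)=\mathrm{Tr}_{\mathfrak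 h}[h\gamma]+\tfrac12\,\mathrm{Tr}_{\mathfrak h\otimes\mathfrak h}\big[V(\mathbf 1-\mathrm{Ex})(\gamma\otimes\gamma)\big]\in(-\infty,\infty],$$ where $\mathrm{Ex}(f\otimes g)=g\otimes f$ is the exchange operator. Let the Hartree–Fock ground state energy $E_{\rm HF}(N)$ be the infimum of the energy $$\sum_{i=1}^N\langle f_i, hf_i\rangle+\tfrac12\sum_{i,j=1}^N\langle f_i\wedge f_j, V(f_i\wedge f_j)\rangle,\qquad f\wedge g=\tfrac1{\sqrt2}(f\otimes g-g\otimes f),$$ of the Slater determinant $f_1\wedge\dots\wedge f_N$ over all orthonormal $f_1,\dots,f_N\in\mathfrak h$. Then $$E_{\rm HF}(N)=\inf\{\mathcal E_{\rm HF}(\gamma):\gamma=\gamma^*=\gamma^2\text{ trace class},\ \mathrm{Tr}\,\gamma=N\}=\inf\{\mathcal E_{\rm HF}(\gamma):\gamma\text{ trace class},\ 0\le\gamma\le\mathbf 1,\ \mathrm{Tr}\,\gamma=N\}.$$ (An infimum over the empty set is $+\infty$.) -/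

import Mathlib

open scoped TensorProduct ENNReal NNReal Topology InnerProductSpace
open Filter

namespace HartreeFock

noncomputable section

/-! ### Trace class operators and traces -/

section Trace

variable {E : Type*} [NormedAddCommGroup E] [InnerProductSpace ℂ E] [CompleteSpace E]

/-- `T` is trace class: `Tr |T| < ∞`, where `|T| = (T* T)^{1/2}` and the trace of the positive
operator `|T|` is the supremum of `∑ ⟨x, |T| x⟩` over all finite orthonormal families. -/
def IsTraceClass (T : E →L[ℂ] E) : Prop :=
  (⨆ (w : Finset E) (_ : Orthonormal ℂ (fun x : w => (x : E))),
    ∑ x ∈ w, ENNReal.ofReal (inner ℂ x (CFC.abs T x)).re) < ⊤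

/-- The trace `∑ ⟨e, T e⟩` of a trace class operator, computed in an orthonormal basis of `E`. -/
def trace (T : E →L[ℂ] E) : ℂ :=
  ∑' e : (exists_hilbertBasis ℂ E).choose, inner ℂ (e : E) (T e)

/-- For a semibounded operator `A`, the quadratic form `⟨x, A x⟩ + m ‖x‖²` of `A + m` on the
domain of `A`. -/
def opForm (A : E →ₗ.[ℂ] E) (m : ℝ) (x : A.domain) : ℝ :=
  (inner ℂ (x : E) (A x)).re + m * ‖(x : E)‖ ^ 2

/-- `r` is the value at `x` of the closure of the quadratic form of `A + m`: there are vectors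
`u n` in the domain of `A` which converge to `x`, which are Cauchy with respect to the form, and
whose form values converge to `r`. -/
def IsFormLimit (A : E →ₗ.[ℂ] E) (m : ℝ) (x : E) (r : ℝ≥0) : Prop :=
  ∃ u : ℕ → A.domain,
    Tendsto (fun n => (u n : E)) atTop (𝓝 x) ∧
    Tendsto (fun p : ℕ × ℕ => opForm A m (u p.1 - u p.2)) atTop (𝓝 0) ∧
    Tendsto (fun n => opForm A m (u n)) atTop (𝓝 (r : ℝ))

/-- The closed quadratic form `x ↦ ⟨x, (A + m) x⟩` of a densely defined symmetric operator `A` with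
`A + m ≥ 0`, with the value `∞` outside of the form domain. (The form of such an operator is
closable, so that there is at most one `r` to take the infimum over. If `A` is essentially
self-adjoint, this is `‖(A + m)^{1/2} x‖²`, with the self-adjoint closure of `A`.) -/
def closedForm (A : E →ₗ.[ℂ] E) (m : ℝ) (x : E) : ℝ≥0∞ :=
  ⨅ (r : ℝ≥0) (_ : IsFormLimit A m x r), (r : ℝ≥0∞)

/-- `Tr[(A + m) T] := Tr[T^{1/2} (A + m) T^{1/2}] ∈ [0, ∞]` for a bounded operator `T ≥ 0` and a
symmetric operator `A` with `A + m ≥ 0`: the supremum, over all finite orthonormal families, of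
the sum of `⟨T^{1/2} x, (A + m) T^{1/2} x⟩`, which is the same as the sum over any
orthonormal basis. -/
def formTrace (A : E →ₗ.[ℂ] E) (m : ℝ) (T : E →L[ℂ] E) : ℝ≥0∞ :=
  ⨆ (w : Finset E) (_ : Orthonormal ℂ (fun x : w => (x : E))),
    ∑ x ∈ w, closedForm A m (CFC.sqrt T x)

end Trace

/-! ### The two-particle space and the Hartree-Fock functional -/

section Functional

variable {H : Type*} [NormedAddCommGroup H] [InnerProductSpace ℂ H] [CompleteSpace H]

/-- The Hilbert space tensor product of `H` with itself. -/
abbrev TwoParticle (H : Type*) [NormedAddCommGroup H] [InnerProductSpace ℂ H] : Type _ :=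
  UniformSpace.Completion (H ⊗[ℂ] H)

/-- The exchange operator `f ⊗ g ↦ g ⊗ f`. -/
def exchange (H : Type*) [NormedAddCommGroup H] [InnerProductSpace ℂ H] :
    TwoParticle H →L[ℂ] TwoParticle H :=
  ContinuousLinearMap.completion
    ((TensorProduct.commIsometry ℂ H H).toContinuousLinearEquiv : H ⊗[ℂ] H →L[ℂ] H ⊗[ℂ] H)

/-- The bounded operator `γ ⊗ γ`. -/
def tensorSquare (γ : H →L[ℂ] H) : TwoParticle H →L[ℂ] TwoParticle H :=
  ContinuousLinearMap.completion (TensorProduct.mapL γ γ)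

/-- The Hartree-Fock functional
`Tr[h γ] + ½ Tr[V (1 - Ex) (γ ⊗ γ)] ∈ (-∞, ∞]`
of a trace class operator `γ ≥ 0`, for a one-particle operator `h` with `h + m ≥ 0` and a pair
interaction `V ≥ 0`. Here `Tr[h γ] = Tr[(h + m) γ] - m Tr γ`, which does not depend on the choice
of the lower bound `-m`. -/
def energy (h : H →ₗ.[ℂ] H) (m : ℝ) (V : TwoParticle H →ₗ.[ℂ] TwoParticle H)
    (γ : H →L[ℂ] H) : EReal :=
  ((formTrace h m γ : ℝ≥0∞) : EReal) - ((m * (trace γ).re : ℝ) : EReal)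
    + ((2⁻¹ * formTrace V 0 ((1 - exchange H) * tensorSquare γ) : ℝ≥0∞) : EReal)

/-- The normalized wedge product `f ∧ g = (f ⊗ g - g ⊗ f) / √2` in the two-particle space. -/
def wedge (f g : H) : TwoParticle H :=
  ((√2 : ℝ) : ℂ)⁻¹ • (((f ⊗ₜ[ℂ] g - g ⊗ₜ[ℂ] f : H ⊗[ℂ] H)) : TwoParticle H)

/-- The energy of the Slater determinant `f₁ ∧ ⋯ ∧ f_N` of orthonormal orbitals,
`∑ i, ⟨f i, h f i⟩ + ½ ∑ i j, ⟨f i ∧ f j, V (f i ∧ f j)⟩ ∈ (-∞, ∞]`,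
where `⟨f i, h f i⟩ = ⟨f i, (h + m) f i⟩ - m`. -/
def slaterEnergy (h : H →ₗ.[ℂ] H) (m : ℝ) (V : TwoParticle H →ₗ.[ℂ] TwoParticle H)
    {N : ℕ} (f : Fin N → H) : EReal :=
  ((∑ i, closedForm h m (f i) : ℝ≥0∞) : EReal) - ((m * N : ℝ) : EReal)
    + ((2⁻¹ * ∑ i, ∑ j, closedForm V 0 (wedge (f i) (f j)) : ℝ≥0∞) : EReal)

/-- The Hartree-Fock ground state energy: the infimum of the energy over all `N`-tuples of
orthonormal orbitals. -/
def groundStateEnergy (h : H →ₗ.[ℂ] H) (m : ℝ) (V : TwoParticle H →ₗ.[ℂ] TwoParticle H)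
    (N : ℕ) : EReal :=
  sInf (slaterEnergy h m V '' {f : Fin N → H | Orthonormal ℂ f})

/-- The infimum of the functional over the rank-`N` orthogonal projections, that is, over the
trace class operators `γ = γ* = γ²` of trace `N`. -/
def projectionEnergy (h : H →ₗ.[ℂ] H) (m : ℝ) (V : TwoParticle H →ₗ.[ℂ] TwoParticle H)
    (N : ℕ) : EReal :=
  sInf (energy h m V '' {γ : H →L[ℂ] H |
    IsSelfAdjoint γ ∧ IsTraceClass γ ∧ trace γ = (N : ℂ) ∧ γ = γ * γ})

/-- The infimum of the functional over all one-particle density matrices of trace `N`. -/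
def relaxedEnergy (h : H →ₗ.[ℂ] H) (m : ℝ) (V : TwoParticle H →ₗ.[ℂ] TwoParticle H)
    (N : ℕ) : EReal :=
  sInf (energy h m V '' {γ : H →L[ℂ] H |
    IsTraceClass γ ∧ trace γ = (N : ℂ) ∧ 0 ≤ γ ∧ γ ≤ 1})

end Functional

end

end HartreeFock

/-!
# Lieb's variational principle for the Hartree-Fock functional

Two of the three inequalities between the infima are direct. A projection is a density matrix, so
the relaxed infimum is at most the one over projections. For orthonormal orbitals `f`, the
projection `γ` onto their span satisfies
`(1 - Ex) (γ ⊗ γ) = 2 ∑_{i < j} |f i ∧ f j⟩⟨f i ∧ f j|`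
(`exchange_tensorSquare_familyProj`), so both terms of the functional are traces of a closed form
against a multiple of a finite-rank projection. Such a trace, a supremum over all finite
orthonormal families, is at most the sum over a basis of the range
(`formTrace_smul_familyProj_le`): on approximating sequences in the operator domain the form is the
square of a Hilbert seminorm, and the bound is Bessel's inequality for a Hilbert-Schmidt norm
(`sum_norm_sq_sum_inner_smul_le`). Hence `energy_familyProj_le`.

The remaining inequality says that the energy of a density matrix `γ` is, up to an arbitrarily
small error, at least that of some Slater determinant. As a positive trace class operator, `γ` is
compact, so it has a Hilbert basis of eigenvectors `u i` with eigenvalues `0 ≤ μ i ≤ 1` and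
`∑ μ i = N`. The vectors `u i ∧ u j`, `i < j`, are orthonormal eigenvectors of
`(1 - Ex) (γ ⊗ γ) ≥ 0` with eigenvalues `2 μ i μ j`, and testing the form traces on the `u i` and
the `u i ∧ u j` gives (`sum_le_formTrace`, `sum_closedForm_wedge_le`)
`energy γ ≥ ∑ μ i ⟨u i, h u i⟩ + ½ ∑ μ i μ j ⟨u i ∧ u j, V (u i ∧ u j)⟩`.
Now only the occupation numbers `μ` matter. The right-hand side has no diagonal interaction terms
and nonnegative off-diagonal ones, so it is concave along every transfer of mass from one occupation
number to another, and one of the two directions does not increase it. Transferring mass between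
two fractional occupation numbers until one of them is `0` or `1`, one arrives at the indicator
function of `N` indices (`exists_rounding_finite`), whose energy is that of a Slater determinant.
Infinitely many nonzero occupation numbers are first cut off to finitely many
(`exists_finite_truncation`), which is the source of the small error.
-/

namespace HartreeFock

/-! ### Rounding of occupation numbers -/

/-- The energy `∑ aᵢ xᵢ + ½ ∑ bᵢⱼ xᵢ xⱼ` of occupation numbers `x` on the finite set `s`. -/
noncomputable def occupationEnergy {ι : Type*} (s : Finset ι) (a : ι → ℝ) (b : ι → ι → ℝ)
    (x : ι → ℝ) : ℝ :=
  ∑ i ∈ s, a i * x i + 2⁻¹ * ∑ i ∈ s, ∑ j ∈ s, b i j * (x i * x j)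

/-- Without diagonal interaction terms, the energy is affine in each occupation number. -/
theorem occupationEnergy_add_single {ι : Type*} [DecidableEq ι] {s : Finset ι} {a : ι → ℝ}
    {b : ι → ι → ℝ} (hb0 : ∀ i, b i i = 0) (hbs : ∀ i j, b i j = b j i) (x : ι → ℝ) (t : ℝ)
    {i : ι} (hi : i ∈ s) :
    occupationEnergy s a b (fun k => x k + t * (if k = i then 1 else 0)) =
      occupationEnergy s a b x + t * (a i + ∑ k ∈ s, b i k * x k) := by
  set v : ι → ℝ := fun k => if k = i then 1 else 0 with hv
  have hsum : ∀ f : ι → ℝ, ∑ k ∈ s, f k * v k = f i := fun f => by simp [hv, hi]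
  have h1 : ∑ k ∈ s, a k * (x k + t * v k) = ∑ k ∈ s, a k * x k + t * a i := by
    rw [← hsum a, Finset.mul_sum, ← Finset.sum_add_distrib]
    exact Finset.sum_congr rfl fun k _ => by ring
  have hB : ∀ y : ι → ℝ, ∑ k ∈ s, ∑ l ∈ s, b k l * (y k * v l) = ∑ k ∈ s, b i k * y k := by
    intro y
    refine Finset.sum_congr rfl fun k _ => ?_
    rw [hbs i k, ← hsum (b k), Finset.sum_mul]
    exact Finset.sum_congr rfl fun l _ => by ring
  have hB' : ∑ k ∈ s, ∑ l ∈ s, b k l * (v k * x l) = ∑ k ∈ s, b i k * x k := by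
    rw [← hB x, Finset.sum_comm]
    exact Finset.sum_congr rfl fun k _ => Finset.sum_congr rfl fun l _ => by
      rw [hbs l k]; ring
  have hvv := hB v
  rw [hsum, hb0] at hvv
  have h2 : ∑ k ∈ s, ∑ l ∈ s, b k l * ((x k + t * v k) * (x l + t * v l))
      = ∑ k ∈ s, ∑ l ∈ s, b k l * (x k * x l)
        + t * ∑ k ∈ s, ∑ l ∈ s, b k l * (x k * v l)
        + t * ∑ k ∈ s, ∑ l ∈ s, b k l * (v k * x l)
        + t ^ 2 * ∑ k ∈ s, ∑ l ∈ s, b k l * (v k * v l) := by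
    simp only [Finset.mul_sum, ← Finset.sum_add_distrib]
    exact Finset.sum_congr rfl fun k _ => Finset.sum_congr rfl fun l _ => by ring
  rw [occupationEnergy, occupationEnergy, h1, h2, hvv, hB x, hB']
  ring

/-- Transferring the amount `t` of occupation from `j` to `i` changes the energy by
a concave quadratic polynomial in `t`: the quadratic coefficient is `-bᵢⱼ`. -/
theorem occupationEnergy_transfer {ι : Type*} [DecidableEq ι] {s : Finset ι} {a : ι → ℝ}
    {b : ι → ι → ℝ} (hb0 : ∀ i, b i i = 0) (hbs : ∀ i j, b i j = b j i) (x : ι → ℝ) (t : ℝ)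
    {i j : ι} (hi : i ∈ s) (hj : j ∈ s) :
    occupationEnergy s a b
        (fun k => x k + t * (if k = i then 1 else 0) + -t * (if k = j then 1 else 0)) =
      occupationEnergy s a b x
        + t * ((a i + ∑ k ∈ s, b i k * x k) - (a j + ∑ k ∈ s, b j k * x k)) - t ^ 2 * b i j := by
  have h : ∑ k ∈ s, b j k * (x k + t * (if k = i then 1 else 0))
      = ∑ k ∈ s, b j k * x k + t * b i j := by
    simp [mul_add, Finset.sum_add_distrib, hi, hbs j i, mul_comm]
  rw [occupationEnergy_add_single hb0 hbs (fun k => x k + t * (if k = i then 1 else 0)) (-t) hj,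
    occupationEnergy_add_single hb0 hbs x t hi, h]
  ring

/-- A sum of numbers of which all but at most one are `0` or `1` is an integer only if the
remaining one is an integer, too. Hence there are at least two fractional occupation numbers as
soon as there is one. -/
theorem exists_ne_fractional {ι : Type*} [DecidableEq ι] {s : Finset ι} {x : ι → ℝ} {N : ℕ}
    (hx : ∀ i ∈ s, 0 ≤ x i ∧ x i ≤ 1) (hN : ∑ i ∈ s, x i = N) {i : ι} (hi : i ∈ s)
    (hi0 : x i ≠ 0) (hi1 : x i ≠ 1) : ∃ j ∈ s, j ≠ i ∧ x j ≠ 0 ∧ x j ≠ 1 := by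
  by_contra! hcon
  have hrest : ∑ k ∈ s.erase i, x k = ((s.erase i).filter (fun k => x k ≠ 0)).card := by
    rw [Finset.card_filter, Nat.cast_sum]
    refine Finset.sum_congr rfl fun k hk => ?_
    rw [Finset.mem_erase] at hk
    by_cases h0 : x k = 0
    · simp [h0]
    · simp [hcon k hk.2 hk.1 h0]
  have h := Finset.add_sum_erase s x hi
  rw [hN, hrest] at h
  set c := ((s.erase i).filter (fun k => x k ≠ 0)).card
  have h0 : 0 < x i := lt_of_le_of_ne (hx i hi).1 hi0.symm
  have h1 : x i < 1 := lt_of_le_of_ne (hx i hi).2 hi1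
  have hlt : (c : ℝ) < N := by linarith
  have hlt' : (N : ℝ) < c + 1 := by linarith
  norm_cast at hlt hlt'
  omega

/-- Finitely many occupation numbers in `[0, 1]` with an integer sum can be rounded to `0` and `1`,
with the same sum and without an increase of the energy. -/
theorem exists_rounding_finite {ι : Type*} [DecidableEq ι] {s : Finset ι} {a : ι → ℝ}
    {b : ι → ι → ℝ} (hb0 : ∀ i, b i i = 0) (hbs : ∀ i j, b i j = b j i) (hb : ∀ i j, 0 ≤ b i j)
    {N : ℕ} (x : ι → ℝ) (hx : ∀ i ∈ s, 0 ≤ x i ∧ x i ≤ 1) (hN : ∑ i ∈ s, x i = N) :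
    ∃ S ⊆ s, S.card = N ∧
      ∑ i ∈ S, a i + 2⁻¹ * ∑ i ∈ S, ∑ j ∈ S, b i j ≤ occupationEnergy s a b x := by
  induction hn : (s.filter (fun i => x i ≠ 0 ∧ x i ≠ 1)).card using Nat.strong_induction_on
    generalizing x with
  | _ n ih =>
  by_cases hfrac : ∃ i ∈ s, x i ≠ 0 ∧ x i ≠ 1
  · obtain ⟨i₀, hi₀, h0, h1⟩ := hfrac
    obtain ⟨j₀, hj₀, hne₀, h0', h1'⟩ := exists_ne_fractional hx hN hi₀ h0 h1
    -- transfer occupation in the direction in which the energy does not increase to first order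
    obtain ⟨i, j, hi, hj, hij, hi0, hi1, hj0, hj1, hD⟩ : ∃ i j, i ∈ s ∧ j ∈ s ∧ i ≠ j ∧
        x i ≠ 0 ∧ x i ≠ 1 ∧ x j ≠ 0 ∧ x j ≠ 1 ∧
        a i + ∑ k ∈ s, b i k * x k ≤ a j + ∑ k ∈ s, b j k * x k := by
      rcases le_total (a i₀ + ∑ k ∈ s, b i₀ k * x k) (a j₀ + ∑ k ∈ s, b j₀ k * x k) with h | h
      · exact ⟨i₀, j₀, hi₀, hj₀, hne₀.symm, h0, h1, h0', h1', h⟩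
      · exact ⟨j₀, i₀, hj₀, hi₀, hne₀, h0', h1', h0, h1, h⟩
    have hxi : x i < 1 := lt_of_le_of_ne (hx i hi).2 hi1
    have hxj : 0 < x j := lt_of_le_of_ne (hx j hj).1 hj0.symm
    set t := min (1 - x i) (x j) with ht
    have ht0 : 0 ≤ t := le_min (by linarith) hxj.le
    have ht1 : t ≤ 1 - x i := min_le_left _ _
    have ht2 : t ≤ x j := min_le_right _ _
    set y : ι → ℝ := fun k => x k + t * (if k = i then 1 else 0)
      + -t * (if k = j then 1 else 0) with hy
    have hyi : y i = x i + t := by simp [hy, hij]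
    have hyj : y j = x j - t := by simp [hy, hij.symm]; ring
    have hyk : ∀ k, k ≠ i → k ≠ j → y k = x k := fun k h h' => by simp [hy, h, h']
    have hy01 : ∀ k ∈ s, 0 ≤ y k ∧ y k ≤ 1 := by
      intro k hk
      by_cases hki : k = i
      · subst hki; rw [hyi]; exact ⟨by linarith [(hx k hk).1], by linarith⟩
      · by_cases hkj : k = j
        · subst hkj; rw [hyj]; exact ⟨by linarith, by linarith [(hx k hk).2]⟩
        · rw [hyk k hki hkj]; exact hx k hk
    have hyN : ∑ k ∈ s, y k = N := by
      simp [hy, Finset.sum_add_distrib, hi, hj, hN]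
    have hlt : (s.filter (fun k => y k ≠ 0 ∧ y k ≠ 1)).card < n := by
      rw [← hn]
      refine Finset.card_lt_card (Finset.ssubset_iff_of_subset ?_ |>.2 ?_)
      · intro k hk
        rw [Finset.mem_filter] at hk ⊢
        refine ⟨hk.1, ?_⟩
        by_cases hki : k = i
        · subst hki; exact ⟨hi0, hi1⟩
        · by_cases hkj : k = j
          · subst hkj; exact ⟨hj0, hj1⟩
          · rw [← hyk k hki hkj]; exact hk.2
      · rcases min_choice (1 - x i) (x j) with h | h
        · refine ⟨i, by simp [hi, hi0, hi1], fun hk => ?_⟩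
          rw [Finset.mem_filter, hyi, ht, h] at hk
          exact hk.2.2 (by ring)
        · refine ⟨j, by simp [hj, hj0, hj1], fun hk => ?_⟩
          rw [Finset.mem_filter, hyj, ht, h] at hk
          exact hk.2.1 (by ring)
    obtain ⟨S, hS, hcard, hle⟩ := ih _ hlt y hy01 hyN rfl
    refine ⟨S, hS, hcard, hle.trans ?_⟩
    rw [hy, occupationEnergy_transfer hb0 hbs x t hi hj]
    nlinarith [mul_nonneg ht0 (sub_nonneg.2 hD), mul_nonneg (sq_nonneg t) (hb i j)]
  · push Not at hfrac
    have hxe : ∀ i ∈ s, x i = if x i ≠ 0 then 1 else 0 := by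
      intro i hi
      by_cases h : x i = 0
      · simp [h]
      · simp [hfrac i hi h]
    refine ⟨s.filter (fun i => x i ≠ 0), Finset.filter_subset _ _, ?_, le_of_eq ?_⟩
    · rw [Finset.sum_congr rfl hxe, ← Nat.cast_one, ← Nat.cast_zero] at hN
      rw [Finset.card_filter]
      exact_mod_cast hN
    · simp only [occupationEnergy, Finset.sum_filter]
      congr 1
      · refine Finset.sum_congr rfl fun i hi => ?_
        by_cases h : x i = 0
        · simp [h]
        · simp [hfrac i hi h]
      · congr 1
        refine Finset.sum_congr rfl fun i hi => ?_
        by_cases h : x i = 0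
        · simp [h]
        · rw [if_pos h]
          refine Finset.sum_congr rfl fun j hj => ?_
          by_cases h' : x j = 0
          · simp [h']
          · simp [hfrac i hi h, hfrac j hj h']

theorem occupationEnergy_nonneg {ι : Type*} {s : Finset ι} {a : ι → ℝ} {b : ι → ι → ℝ}
    (ha : ∀ i, 0 ≤ a i) (hb : ∀ i j, 0 ≤ b i j) {x : ι → ℝ} (hx : ∀ i, 0 ≤ x i) :
    0 ≤ occupationEnergy s a b x :=
  add_nonneg (Finset.sum_nonneg fun i _ => mul_nonneg (ha i) (hx i))
    (mul_nonneg (by norm_num) (Finset.sum_nonneg fun i _ => Finset.sum_nonneg fun j _ =>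
      mul_nonneg (hb i j) (mul_nonneg (hx i) (hx j))))

/-- A summable family of occupation numbers in `[0, 1]` with sum `N` can be cut off to a finite
subset of its support, with the sum restored, at the cost of an arbitrarily small increase of the
energy. The mass lost in the tail is put on one fixed fractional occupation number. -/
theorem exists_finite_truncation {ι : Type*} {a : ι → ℝ} {b : ι → ι → ℝ}
    (hb0 : ∀ i, b i i = 0) (hbs : ∀ i j, b i j = b j i) (ha : ∀ i, 0 ≤ a i)
    (hb : ∀ i j, 0 ≤ b i j) {N : ℕ} {x : ι → ℝ} (hx0 : ∀ i, 0 ≤ x i) (hx1 : ∀ i, x i ≤ 1)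
    (hN : HasSum x N) {X : ℝ} (hX : ∀ s, occupationEnergy s a b x ≤ X) {δ : ℝ} (hδ : 0 < δ) :
    ∃ (s : Finset ι) (y : ι → ℝ), (∀ i ∈ s, x i ≠ 0) ∧ (∀ i ∈ s, 0 ≤ y i ∧ y i ≤ 1) ∧
      ∑ i ∈ s, y i = N ∧ occupationEnergy s a b y ≤ X + δ := by
  classical
  have key : ∀ ε > 0, ∃ s₀ : Finset ι, ∀ s, s₀ ⊆ s →
      ∑ i ∈ s.filter (fun i => x i ≠ 0), x i ≤ N ∧
      N - ε < ∑ i ∈ s.filter (fun i => x i ≠ 0), x i := by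
    intro ε hε
    obtain ⟨s₀, hs₀⟩ := Filter.eventually_atTop.1
      (hN.eventually (lt_mem_nhds (show (N : ℝ) - ε < N by linarith)))
    refine ⟨s₀, fun s hs => ?_⟩
    rw [Finset.sum_filter_ne_zero]
    exact ⟨sum_le_hasSum s (fun i _ => hx0 i) hN, hs₀ s hs⟩
  by_cases hfrac : ∃ k, x k ≠ 0 ∧ x k ≠ 1
  · obtain ⟨k, hk0, hk1⟩ := hfrac
    have hkpos : 0 < x k := lt_of_le_of_ne (hx0 k) hk0.symm
    have hklt : x k < 1 := lt_of_le_of_ne (hx1 k) hk1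
    have hX0 : 0 ≤ X := (occupationEnergy_nonneg ha hb hx0).trans (hX ∅)
    obtain ⟨s₀, hs₀⟩ := key (min (1 - x k) (δ * x k / (X + 1)))
      (lt_min (by linarith) (by positivity))
    obtain ⟨hle, hlt⟩ := hs₀ (insert k s₀) (Finset.subset_insert _ _)
    set s := (insert k s₀).filter (fun i => x i ≠ 0) with hs
    have hks : k ∈ s := by simp [hs, hk0]
    set t : ℝ := N - ∑ i ∈ s, x i with ht
    have ht0 : 0 ≤ t := by linarith
    have ht1 : t ≤ 1 - x k := by linarith [min_le_left (1 - x k) (δ * x k / (X + 1))]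
    have ht2 : t ≤ δ * x k / (X + 1) := by
      linarith [min_le_right (1 - x k) (δ * x k / (X + 1))]
    refine ⟨s, fun i => x i + t * (if i = k then 1 else 0), ?_, ?_, ?_, ?_⟩
    · intro i hi
      exact (Finset.mem_filter.1 hi).2
    · intro i _
      by_cases hik : i = k
      · subst hik
        simp only [if_true, mul_one]
        exact ⟨by linarith [hx0 i], by linarith⟩
      · simp [hik, hx0, hx1]
    · simp [Finset.sum_add_distrib, hks, ht]
    · rw [occupationEnergy_add_single hb0 hbs x t hks]
      set D := a k + ∑ l ∈ s, b k l * x l with hD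
      -- emptying the orbital `k` leaves a nonnegative energy, which bounds the derivative `D`
      have hDX : x k * D ≤ X := by
        have h := occupationEnergy_add_single (a := a) hb0 hbs x (-x k) hks
        have h' : 0 ≤ occupationEnergy s a b (fun l => x l + -x k * (if l = k then 1 else 0)) := by
          refine occupationEnergy_nonneg ha hb fun l => ?_
          by_cases hlk : l = k
          · simp [hlk]
          · simp [hlk, hx0]
        rw [h, ← hD] at h'
        linarith [hX s]
      have hD0 : 0 ≤ D := add_nonneg (ha k)
        (Finset.sum_nonneg fun l _ => mul_nonneg (hb k l) (hx0 l))
      have h1 : t * D ≤ δ := by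
        calc t * D ≤ δ * x k / (X + 1) * D := mul_le_mul_of_nonneg_right ht2 hD0
          _ = δ * ((x k * D) / (X + 1)) := by ring
          _ ≤ δ * 1 := by
            refine mul_le_mul_of_nonneg_left ?_ hδ.le
            rw [div_le_one (by linarith)]
            linarith
          _ = δ := mul_one δ
      linarith [hX s]
  · push Not at hfrac
    obtain ⟨s₀, hs₀⟩ := key 1 one_pos
    obtain ⟨hle, hlt⟩ := hs₀ s₀ subset_rfl
    refine ⟨s₀.filter (fun i => x i ≠ 0), x, fun i hi => (Finset.mem_filter.1 hi).2,
      fun i _ => ⟨hx0 i, hx1 i⟩, ?_, (hX _).trans (by linarith)⟩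
    have hcard : ∑ i ∈ s₀.filter (fun i => x i ≠ 0), x i
        = ((s₀.filter (fun i => x i ≠ 0)).card : ℝ) := by
      rw [Finset.sum_congr rfl fun i hi => hfrac i (Finset.mem_filter.1 hi).2]
      simp
    rw [hcard] at hle hlt ⊢
    have hlt' : (N : ℝ) < ((s₀.filter (fun i => x i ≠ 0)).card + 1 : ℕ) := by
      push_cast; linarith
    exact congrArg _ (le_antisymm (Nat.cast_le.1 hle) (Nat.lt_succ_iff.1 (Nat.cast_lt.1 hlt')))

/-- Occupation numbers in `[0, 1]` with sum `N` can be rounded to the indicator function of a set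
of `N` elements, at the cost of an arbitrarily small increase of the energy. -/
theorem exists_rounding {ι : Type*} {a : ι → ℝ≥0∞} {b : ι → ι → ℝ≥0∞}
    (hb0 : ∀ i, b i i = 0) (hbs : ∀ i j, b i j = b j i) {N : ℕ} {x : ι → ℝ}
    (hx0 : ∀ i, 0 ≤ x i) (hx1 : ∀ i, x i ≤ 1) (hN : HasSum x N) {X : ℝ≥0∞} (hX : X ≠ ⊤)
    (hle : ∀ s : Finset ι, ∑ i ∈ s, ENNReal.ofReal (x i) * a i
      + 2⁻¹ * ∑ i ∈ s, ∑ j ∈ s, ENNReal.ofReal (x i * x j) * b i j ≤ X)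
    {δ : ℝ} (hδ : 0 < δ) :
    ∃ S : Finset ι, S.card = N ∧
      ∑ i ∈ S, a i + 2⁻¹ * ∑ i ∈ S, ∑ j ∈ S, b i j ≤ X + ENNReal.ofReal δ := by
  classical
  have hxpos : ∀ i, x i ≠ 0 → 0 < x i := fun i h => lt_of_le_of_ne (hx0 i) h.symm
  have hfa : ∀ i, x i ≠ 0 → a i ≠ ⊤ := by
    intro i hi htop
    have h := hle {i}
    simp only [Finset.sum_singleton, htop] at h
    rw [ENNReal.mul_top (by simpa using hxpos i hi), top_add] at h
    exact hX (top_le_iff.1 h)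
  have hfb : ∀ i j, x i ≠ 0 → x j ≠ 0 → b i j ≠ ⊤ := by
    intro i j hi hj htop
    have hmem : ENNReal.ofReal (x i * x j) * b i j ≤ ∑ k ∈ ({i, j} : Finset ι),
        ∑ l ∈ ({i, j} : Finset ι), ENNReal.ofReal (x k * x l) * b k l :=
      (Finset.single_le_sum (f := fun l => ENNReal.ofReal (x i * x l) * b i l)
        (fun _ _ => zero_le) (by simp : j ∈ ({i, j} : Finset ι))).trans
      (Finset.single_le_sum (f := fun k => ∑ l ∈ ({i, j} : Finset ι),
        ENNReal.ofReal (x k * x l) * b k l) (fun _ _ => zero_le)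
        (by simp : i ∈ ({i, j} : Finset ι)))
    rw [htop, ENNReal.mul_top (by simpa using mul_pos (hxpos i hi) (hxpos j hj)),
      top_le_iff] at hmem
    have h := hle {i, j}
    rw [hmem, ENNReal.mul_top (by simp), add_top] at h
    exact hX (top_le_iff.1 h)
  have hsymm : ∀ i j, (b i j).toReal = (b j i).toReal := fun i j => by rw [hbs]
  have hdiag : ∀ i, (b i i).toReal = 0 := fun i => by rw [hb0]; rfl
  have hocc : ∀ s, occupationEnergy s (fun i => (a i).toReal) (fun i j => (b i j).toReal) x
      ≤ X.toReal := by
    intro s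
    rw [← ENNReal.ofReal_le_iff_le_toReal hX]
    refine le_trans ?_ (hle s)
    have h2 : ENNReal.ofReal 2⁻¹ = 2⁻¹ := by
      rw [ENNReal.ofReal_inv_of_pos two_pos]; simp
    rw [occupationEnergy, ENNReal.ofReal_add
      (Finset.sum_nonneg fun i _ => mul_nonneg ENNReal.toReal_nonneg (hx0 i))
      (mul_nonneg (by norm_num) (Finset.sum_nonneg fun i _ => Finset.sum_nonneg fun j _ =>
        mul_nonneg ENNReal.toReal_nonneg (mul_nonneg (hx0 i) (hx0 j)))),
      ENNReal.ofReal_mul (by norm_num), h2,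
      ENNReal.ofReal_sum_of_nonneg fun i _ => mul_nonneg ENNReal.toReal_nonneg (hx0 i),
      ENNReal.ofReal_sum_of_nonneg fun i _ => Finset.sum_nonneg fun j _ =>
        mul_nonneg ENNReal.toReal_nonneg (mul_nonneg (hx0 i) (hx0 j))]
    gcongr with i _ i _
    · rw [mul_comm, ENNReal.ofReal_mul (hx0 i)]
      gcongr
      exact ENNReal.ofReal_toReal_le
    · rw [ENNReal.ofReal_sum_of_nonneg fun j _ =>
        mul_nonneg ENNReal.toReal_nonneg (mul_nonneg (hx0 i) (hx0 j))]
      gcongr with j _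
      rw [mul_comm, ENNReal.ofReal_mul (mul_nonneg (hx0 i) (hx0 j))]
      gcongr
      exact ENNReal.ofReal_toReal_le
  obtain ⟨s, y, hsx, hy, hyN, hyX⟩ := exists_finite_truncation hdiag hsymm
    (fun i => ENNReal.toReal_nonneg) (fun i j => ENNReal.toReal_nonneg) hx0 hx1 hN hocc hδ
  obtain ⟨S, hSs, hcard, hS⟩ := exists_rounding_finite hdiag hsymm
    (fun i j => ENNReal.toReal_nonneg) y hy hyN
  refine ⟨S, hcard, ?_⟩
  have hfa' : ∀ i ∈ S, a i ≠ ⊤ := fun i hi => hfa i (hsx i (hSs hi))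
  have hfb' : ∀ i ∈ S, ∀ j ∈ S, b i j ≠ ⊤ := fun i hi j hj =>
    hfb i j (hsx i (hSs hi)) (hsx j (hSs hj))
  have h1 : ∑ i ∈ S, a i ≠ ⊤ := ENNReal.sum_ne_top.2 hfa'
  have h2 : ∑ i ∈ S, ∑ j ∈ S, b i j ≠ ⊤ :=
    ENNReal.sum_ne_top.2 fun i hi => ENNReal.sum_ne_top.2 (hfb' i hi)
  have h3 : 2⁻¹ * ∑ i ∈ S, ∑ j ∈ S, b i j ≠ ⊤ := ENNReal.mul_ne_top (by simp) h2
  rw [← ENNReal.ofReal_toReal hX, ← ENNReal.ofReal_add ENNReal.toReal_nonneg hδ.le,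
    ENNReal.le_ofReal_iff_toReal_le (ENNReal.add_ne_top.2 ⟨h1, h3⟩)
      (add_nonneg ENNReal.toReal_nonneg hδ.le),
    ENNReal.toReal_add h1 h3, ENNReal.toReal_mul, ENNReal.toReal_sum hfa',
    ENNReal.toReal_sum fun i hi => ENNReal.sum_ne_top.2 (hfb' i hi),
    Finset.sum_congr rfl fun i hi => ENNReal.toReal_sum (hfb' i hi)]
  simpa using hS.trans hyX

/-! ### A trace inequality for finite families -/

/-- The norms of all linear combinations of a finite family of vectors in a (semi-)inner product
space are those of the corresponding combinations of vectors in a coordinate space. -/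
theorem exists_coordinates {K ι : Type*} [SeminormedAddCommGroup K] [InnerProductSpace ℂ K]
    [Fintype ι] (u : ι → K) : ∃ (n : ℕ) (v : Fin n → ι → ℂ), ∀ c : ι → ℂ,
      ‖∑ i, c i • u i‖ ^ 2 = ∑ k, ‖∑ i, star (c i) * v k i‖ ^ 2 := by
  obtain ⟨n, v, hv⟩ := Matrix.posSemidef_iff_eq_sum_vecMulVec.1 (Matrix.posSemidef_gram ℂ u)
  refine ⟨n, v, fun c => ?_⟩
  have h := Matrix.star_dotProduct_gram_mulVec (𝕜 := ℂ) u c c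
  rw [inner_self_eq_norm_sq_to_K, hv] at h
  have h' : star c ⬝ᵥ (∑ k, Matrix.vecMulVec (v k) (star (v k))).mulVec c
      = ((∑ k, ‖∑ i, star (c i) * v k i‖ ^ 2 : ℝ) : ℂ) := by
    rw [Matrix.sum_mulVec, dotProduct_sum]
    push_cast
    refine Finset.sum_congr rfl fun k _ => ?_
    rw [Matrix.vecMulVec_mulVec, ← Complex.mul_conj']
    rw [map_sum]
    simp only [dotProduct, Pi.smul_apply, op_smul_eq_mul, ← mul_assoc, ← Finset.sum_mul]
    congr 1
    simp [mul_comm]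
  rw [h'] at h
  exact (Complex.ofReal_injective (by simpa using h)).symm

/-- If a finite orthonormal family `f` is mapped to a family `u`, the operator
`x ↦ ∑ ⟨f i, x⟩ u i` has squared Hilbert-Schmidt norm `∑ ‖u i‖²`; hence the sum of its squared
values on any orthonormal family is at most `∑ ‖u i‖²`. -/
theorem sum_norm_sq_sum_inner_smul_le {E K ι : Type*} [NormedAddCommGroup E]
    [InnerProductSpace ℂ E] [SeminormedAddCommGroup K] [InnerProductSpace ℂ K] [Fintype ι]
    {f : ι → E} (hf : Orthonormal ℂ f) {w : Finset E}
    (hw : Orthonormal ℂ (fun x : w => (x : E))) (u : ι → K) :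
    ∑ x ∈ w, ‖∑ i, inner ℂ (f i) x • u i‖ ^ 2 ≤ ∑ i, ‖u i‖ ^ 2 := by
  classical
  obtain ⟨n, v, hv⟩ := exists_coordinates u
  have hu : ∀ i, ‖u i‖ ^ 2 = ∑ k, ‖v k i‖ ^ 2 := by
    intro i
    have h := hv (Pi.single i 1)
    simpa [Pi.single_apply, apply_ite] using h
  simp_rw [hv, hu]
  rw [Finset.sum_comm, Finset.sum_comm (s := Finset.univ (α := ι))]
  refine Finset.sum_le_sum fun k _ => ?_
  have hbessel := hw.sum_inner_products_le (∑ i, v k i • f i) (s := Finset.univ)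
  have hnorm : ‖∑ i, v k i • f i‖ ^ 2 = ∑ i, ‖v k i‖ ^ 2 := by
    have h := hf.inner_sum (v k) (v k) Finset.univ
    rw [inner_self_eq_norm_sq_to_K] at h
    simp_rw [Complex.conj_mul'] at h
    exact Complex.ofReal_injective (by simpa using h)
  rw [hnorm] at hbessel
  refine le_trans (le_of_eq ?_) hbessel
  rw [← Finset.sum_coe_sort w]
  refine Finset.sum_congr rfl fun x _ => ?_
  simp [inner_sum, inner_smul_right, mul_comm]

/-! ### Closed quadratic forms -/

section ClosedForm

universe u

variable {E : Type u} [NormedAddCommGroup E] [InnerProductSpace ℂ E]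
  {A : E →ₗ.[ℂ] E} {m : ℝ}

/-- The quadratic form of a symmetric operator `A` with `A + m ≥ 0` is the square of a seminorm
that comes from a semi-inner product. -/
theorem exists_opForm_eq_norm_sq (hA : A.IsFormalAdjoint A) (hpos : ∀ x, 0 ≤ opForm A m x) :
    ∃ (K : Type u) (_ : SeminormedAddCommGroup K) (_ : InnerProductSpace ℂ K)
      (T : A.domain →ₗ[ℂ] K), ∀ x, opForm A m x = ‖T x‖ ^ 2 := by
  let c : PreInnerProductSpace.Core ℂ A.domain :=
    { inner := fun x y => inner ℂ (x : E) (A y) + m * inner ℂ (x : E) (y : E)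
      conj_inner_symm := fun x y => by
        simp [inner_conj_symm, hA x y]
      re_inner_nonneg := fun x => by
        have h := hpos x
        rw [opForm, ← inner_self_eq_norm_sq (𝕜 := ℂ)] at h
        simpa using h
      add_left := fun x y z => by
        simp; ring
      smul_left := fun x y r => by
        simp; ring }
  let i₁ : SeminormedAddCommGroup A.domain :=
    @InnerProductSpace.Core.toSeminormedAddCommGroup ℂ A.domain _ _ _ c
  let i₂ := @InnerProductSpace.ofCore ℂ A.domain _ _ _ c
  refine ⟨A.domain, i₁, i₂, LinearMap.id, fun x => ?_⟩
  rw [← @inner_self_eq_norm_sq ℂ A.domain _ i₁ i₂, opForm, ← inner_self_eq_norm_sq (𝕜 := ℂ)]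
  change _ = RCLike.re (inner ℂ (x : E) (A x) + m * inner ℂ (x : E) (x : E))
  simp

theorem IsFormLimit.smul {x : E} {r : ℝ≥0} (h : IsFormLimit A m x r) (c : ℂ) :
    IsFormLimit A m (c • x) (‖c‖₊ ^ 2 * r) := by
  have hsmul : ∀ y : A.domain, opForm A m (c • y) = ‖c‖ ^ 2 * opForm A m y := by
    intro y
    have h1 : inner ℂ ((c • y : A.domain) : E) (A (c • y))
        = ((‖c‖ ^ 2 : ℝ) : ℂ) * inner ℂ (y : E) (A y) := by
      rw [LinearPMap.map_smul, Submodule.coe_smul, inner_smul_left, inner_smul_right, ← mul_assoc,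
        Complex.conj_mul']
      norm_cast
    rw [opForm, opForm, h1, Complex.re_ofReal_mul, Submodule.coe_smul, norm_smul]
    ring
  obtain ⟨u, hu, hcauchy, hlim⟩ := h
  refine ⟨fun n => c • u n, by simpa using hu.const_smul c, ?_, ?_⟩
  · simpa [← smul_sub, hsmul] using hcauchy.const_mul (‖c‖ ^ 2)
  · simpa [hsmul] using hlim.const_mul (‖c‖ ^ 2)

@[simp]
theorem closedForm_zero : closedForm A m 0 = 0 := by
  refine le_antisymm ?_ zero_le
  have h : IsFormLimit A m 0 0 := ⟨fun _ => 0, by simp, by simp [opForm], by simp [opForm]⟩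
  rw [closedForm]
  simpa only [ENNReal.coe_zero] using
    iInf₂_le (f := fun (r : ℝ≥0) (_ : IsFormLimit A m 0 r) => (r : ℝ≥0∞)) 0 h

theorem closedForm_smul (c : ℂ) (x : E) :
    closedForm A m (c • x) = ‖c‖ₑ ^ 2 * closedForm A m x := by
  by_cases hc : c = 0
  · simp [hc]
  have key : ∀ (d : ℂ) (y : E), d ≠ 0 → closedForm A m (d • y) ≤ ‖d‖ₑ ^ 2 * closedForm A m y := by
    intro d y hd
    have h0 : ‖d‖ₑ ^ 2 ≠ 0 := by simpa using hd
    have htop : ‖d‖ₑ ^ 2 ≠ ⊤ := by simp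
    rw [closedForm, closedForm, ENNReal.mul_iInf_of_ne h0 htop]
    refine le_iInf fun r => ?_
    rw [ENNReal.mul_iInf_of_ne h0 htop]
    exact le_iInf fun hr => (iInf₂_le _ (hr.smul d)).trans (by simp [enorm_eq_nnnorm])
  refine le_antisymm (key c x hc) ?_
  have h := key c⁻¹ (c • x) (inv_ne_zero hc)
  rw [inv_smul_smul₀ hc] at h
  calc ‖c‖ₑ ^ 2 * closedForm A m x
      ≤ ‖c‖ₑ ^ 2 * (‖c⁻¹‖ₑ ^ 2 * closedForm A m (c • x)) := by gcongr
    _ = closedForm A m (c • x) := by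
      rw [← mul_assoc, ← mul_pow, ← enorm_mul, mul_inv_cancel₀ hc]
      simp

theorem closedForm_neg (x : E) : closedForm A m (-x) = closedForm A m x := by
  simpa using closedForm_smul (A := A) (m := m) (-1) x

/-- The trace of a closed form over the range of the projection onto a finite orthonormal family
`f` is computed in the basis `f`: other orthonormal families do not give more. -/
theorem sum_closedForm_le (hA : A.IsFormalAdjoint A) (hpos : ∀ x, 0 ≤ opForm A m x)
    {ι : Type*} [Fintype ι] {f : ι → E} (hf : Orthonormal ℂ f) {w : Finset E}
    (hw : Orthonormal ℂ (fun x : w => (x : E))) :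
    ∑ x ∈ w, closedForm A m (∑ i, inner ℂ (f i) x • f i) ≤ ∑ i, closedForm A m (f i) := by
  obtain ⟨K, _, _, T, hT⟩ := exists_opForm_eq_norm_sq hA hpos
  -- it suffices to bound the left-hand side for given form values at the vectors `f i`
  suffices h : ∀ r : ι → ℝ≥0, (∀ i, IsFormLimit A m (f i) (r i)) →
      ∑ x ∈ w, closedForm A m (∑ i, inner ℂ (f i) x • f i) ≤ ∑ i, (r i : ℝ≥0∞) by
    by_cases htop : ∃ i, closedForm A m (f i) = ⊤
    · obtain ⟨i, hi⟩ := htop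
      rw [ENNReal.sum_eq_top.2 ⟨i, Finset.mem_univ i, hi⟩]
      exact le_top
    push Not at htop
    refine ENNReal.le_of_forall_pos_le_add fun ε hε _ => ?_
    have hex : ∀ i, ∃ r, IsFormLimit A m (f i) r ∧
        (r : ℝ≥0∞) < closedForm A m (f i) + (ε / (Fintype.card ι + 1) : ℝ≥0) := by
      intro i
      have hlt : closedForm A m (f i)
          < closedForm A m (f i) + (ε / (Fintype.card ι + 1) : ℝ≥0) :=
        ENNReal.lt_add_right (htop i) (by simpa using hε.ne')
      conv_lhs at hlt => rw [closedForm]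
      simpa only [iInf_lt_iff, exists_prop] using hlt
    choose r hr hrlt using hex
    refine (h r hr).trans ?_
    refine (Finset.sum_le_sum fun i _ => (hrlt i).le).trans ?_
    rw [Finset.sum_add_distrib]
    gcongr
    rw [Finset.sum_const, nsmul_eq_mul]
    norm_cast
    rw [Finset.card_univ, ← mul_div_assoc, mul_comm, mul_div_assoc]
    refine mul_le_of_le_one_right' (div_le_one_of_le₀ ?_ (by positivity))
    simp
  intro r hr
  choose u hu hcauchy hlim using hr
  have hTcauchy : ∀ i, CauchySeq (fun n => T (u i n)) := by
    intro i
    rw [cauchySeq_iff_tendsto_dist_atTop_0]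
    have h := (hcauchy i).sqrt
    simpa [hT, dist_eq_norm, Real.sqrt_sq] using h
  -- the combinations of the approximating sequences approximate the combinations of the `f i`
  let z : E → ℕ → A.domain := fun x n => ∑ i, inner ℂ (f i) x • u i n
  have hz : ∀ x, CauchySeq (fun n => T (z x n)) := by
    intro x
    simp only [z, map_sum, map_smul]
    have h : ∀ s : Finset ι, CauchySeq (fun n => ∑ i ∈ s, inner ℂ (f i) x • T (u i n)) := by
      classical
      intro s
      induction s using Finset.induction_on with
      | empty => simpa using cauchySeq_const (0 : K)
      | insert i s hi ih =>
        simp only [Finset.sum_insert hi]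
        exact ((uniformContinuous_const_smul (inner ℂ (f i) x)).comp_cauchySeq (hTcauchy i)).add ih
    exact h Finset.univ
  have hval : ∀ x, ∃ t : ℝ≥0, Tendsto (fun n => ‖T (z x n)‖ ^ 2) atTop (𝓝 (t : ℝ)) := by
    intro x
    obtain ⟨l, hl⟩ := cauchySeq_tendsto_of_complete
      (uniformContinuous_norm.comp_cauchySeq (hz x))
    exact ⟨⟨l ^ 2, sq_nonneg l⟩, hl.pow 2⟩
  choose t ht using hval
  have hlimit : ∀ x, IsFormLimit A m (∑ i, inner ℂ (f i) x • f i) (t x) := by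
    intro x
    refine ⟨z x, ?_, ?_, ?_⟩
    · simp only [z, Submodule.coe_sum, Submodule.coe_smul]
      exact tendsto_finsetSum _ fun i _ => (hu i).const_smul _
    · have h := (cauchySeq_iff_tendsto_dist_atTop_0.1 (hz x)).pow 2
      simpa [hT, dist_eq_norm] using h
    · simpa [hT] using ht x
  refine (Finset.sum_le_sum fun x _ => iInf₂_le (t x) (hlimit x)).trans ?_
  norm_cast
  rw [← NNReal.coe_le_coe]
  push_cast
  refine le_of_tendsto_of_tendsto' (tendsto_finsetSum _ fun x _ => ht x)
    (tendsto_finsetSum _ fun i _ => hlim i) fun n => ?_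
  simp only [hT, z, map_sum, map_smul]
  exact sum_norm_sq_sum_inner_smul_le hf hw fun i => T (u i n)

end ClosedForm

/-! ### Projections onto finite orthonormal families -/

section Projection

variable {E : Type*} [NormedAddCommGroup E] [InnerProductSpace ℂ E] {ι : Type*} [Fintype ι]

/-- The operator `∑ |f i⟩⟨f i|`, which is the orthogonal projection onto the span of `f` if the
finite family `f` is orthonormal. -/
noncomputable def familyProj (f : ι → E) : E →L[ℂ] E :=
  ∑ i, InnerProductSpace.rankOne ℂ (f i) (f i)

theorem familyProj_apply (f : ι → E) (x : E) : familyProj f x = ∑ i, inner ℂ (f i) x • f i := by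
  simp [familyProj]

theorem inner_familyProj (f : ι → E) (x : E) :
    inner ℂ x (familyProj f x) = ((∑ i, ‖inner ℂ (f i) x‖ ^ 2 : ℝ) : ℂ) := by
  rw [familyProj_apply, inner_sum]
  push_cast
  refine Finset.sum_congr rfl fun i _ => ?_
  rw [inner_smul_right, ← inner_conj_symm x (f i), Complex.mul_conj']

theorem familyProj_mul_self {f : ι → E} (hf : Orthonormal ℂ f) :
    familyProj f * familyProj f = familyProj f := by
  classical
  ext x
  rw [mul_apply_eq_comp, familyProj_apply f (familyProj f x), familyProj_apply f x]
  simp only [hf.inner_right_fintype]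

theorem familyProj_nonneg (f : ι → E) : 0 ≤ familyProj f := by
  rw [ContinuousLinearMap.nonneg_iff_isPositive, familyProj]
  exact ContinuousLinearMap.isPositive_sum _ fun i _ =>
    InnerProductSpace.isPositive_rankOne_self (f i)

theorem isCompactOperator_familyProj (f : ι → E) : IsCompactOperator (familyProj f) := by
  have h : familyProj f ∈ compactOperator (RingHom.id ℂ) E E := by
    refine Submodule.sum_mem _ fun i _ => ?_
    rw [InnerProductSpace.rankOne_def']
    exact (isCompactOperator_of_locallyCompactSpace_rng
      (ContinuousLinearMap.toSpanSingleton ℂ (f i))).comp_clm _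
  exact h

theorem norm_sub_familyProj_sq {f : ι → E} (hf : Orthonormal ℂ f) (x : E) :
    ‖x - familyProj f x‖ ^ 2 = ‖x‖ ^ 2 - ∑ i, ‖inner ℂ (f i) x‖ ^ 2 := by
  have h1 : ‖familyProj f x‖ ^ 2 = ∑ i, ‖inner ℂ (f i) x‖ ^ 2 := by
    rw [familyProj_apply]
    have h := hf.inner_sum (fun i => inner ℂ (f i) x) (fun i => inner ℂ (f i) x) Finset.univ
    rw [inner_self_eq_norm_sq_to_K] at h
    simp_rw [Complex.conj_mul'] at h
    exact Complex.ofReal_injective (by simpa using h)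
  rw [@norm_sub_sq ℂ, inner_familyProj, h1]
  simp only [RCLike.re_eq_complex_re, Complex.ofReal_re]
  ring

end Projection

/-! ### Traces of operators and of forms -/

section Trace

universe u

variable {E : Type*} [NormedAddCommGroup E] [InnerProductSpace ℂ E]

/-- A supremum over finite orthonormal sets bounds the sums over finite parts of any orthonormal
family. -/
theorem sum_le_iSup_orthonormal {ι : Type*} {g : ι → E} (hg : Orthonormal ℂ g) (s : Finset ι)
    (F : E → ℝ≥0∞) : ∑ i ∈ s, F (g i) ≤
      ⨆ (w : Finset E) (_ : Orthonormal ℂ (fun x : w => (x : E))), ∑ x ∈ w, F x := by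
  classical
  have hinj : Function.Injective g := hg.linearIndependent.injective
  rw [← Finset.sum_image (f := F) hinj.injOn]
  refine le_iSup₂_of_le (s.image g) ?_ le_rfl
  refine hg.toSubtypeRange.comp
    (fun x : s.image g => (⟨x, ?_⟩ : Set.range g)) fun x y h => ?_
  · obtain ⟨i, _, hi⟩ := Finset.mem_image.1 x.2
    exact ⟨i, hi⟩
  · exact Subtype.ext (congrArg (fun z : Set.range g => (z : E)) h)

/-- Parseval's identity. -/
theorem hasSum_norm_inner_sq {ι : Type*} (b : HilbertBasis ι ℂ E) (x : E) :
    HasSum (fun i => ‖inner ℂ (b i) x‖ ^ 2) (‖x‖ ^ 2) := by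
  have h := b.hasSum_inner_mul_inner x x
  have h1 : ∀ i, inner ℂ x (b i) * inner ℂ (b i) x = ((‖inner ℂ (b i) x‖ ^ 2 : ℝ) : ℂ) := by
    intro i
    rw [← inner_conj_symm x (b i), Complex.conj_mul']
    push_cast
    rfl
  rw [inner_self_eq_norm_sq_to_K] at h
  simp only [h1] at h
  exact Complex.hasSum_ofReal.1 (by simpa using h)

theorem tsum_enorm_inner_sq {ι : Type*} (b : HilbertBasis ι ℂ E) (x : E) :
    ∑' i, ‖inner ℂ (b i) x‖ₑ ^ 2 = ‖x‖ₑ ^ 2 := by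
  have h2 := hasSum_norm_inner_sq b x
  have h3 := ENNReal.ofReal_tsum_of_nonneg (fun i => sq_nonneg _) h2.summable
  rw [h2.tsum_eq, ENNReal.ofReal_pow (norm_nonneg _), ofReal_norm] at h3
  rw [h3]
  exact tsum_congr fun i => by rw [ENNReal.ofReal_pow (norm_nonneg _), ofReal_norm]

/-- The squared Hilbert-Schmidt norm of a symmetric operator does not depend on the basis. -/
theorem tsum_enorm_apply_sq_eq {ι κ : Type*} (b : HilbertBasis ι ℂ E) (e : HilbertBasis κ ℂ E)
    {S : E →L[ℂ] E} (hS : S.IsSymmetric) :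
    ∑' i, ‖S (b i)‖ₑ ^ 2 = ∑' k, ‖S (e k)‖ₑ ^ 2 := by
  simp_rw [← tsum_enorm_inner_sq e (S (b _)), ← tsum_enorm_inner_sq b (S (e _))]
  rw [ENNReal.tsum_comm]
  refine tsum_congr fun k => tsum_congr fun i => ?_
  rw [← hS.apply_clm, ← ofReal_norm, norm_inner_symm, ofReal_norm]

variable [CompleteSpace E]

theorem inner_apply_eq_norm_sqrt_sq {T : E →L[ℂ] E} (hT : 0 ≤ T) (x : E) :
    inner ℂ x (T x) = ((‖CFC.sqrt T x‖ ^ 2 : ℝ) : ℂ) := by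
  have hS := (ContinuousLinearMap.nonneg_iff_isPositive _).1 (CFC.sqrt_nonneg T)
  conv_lhs => rw [← CFC.sqrt_mul_sqrt_self T hT, mul_apply_eq_comp]
  rw [← hS.inner_left_eq_inner_right, inner_self_eq_norm_sq_to_K]
  simp

/-- The square root of a positive operator acts on an eigenvector by the root of the
eigenvalue. -/
theorem sqrt_apply_of_eigenvector {T : E →L[ℂ] E} (hT : 0 ≤ T) {x : E} {μ : ℝ} (hμ : 0 ≤ μ)
    (hx : T x = (μ : ℂ) • x) : CFC.sqrt T x = ((√μ : ℝ) : ℂ) • x := by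
  set S := CFC.sqrt T with hSdef
  have hS := (ContinuousLinearMap.nonneg_iff_isPositive _).1 (CFC.sqrt_nonneg T)
  rw [← hSdef] at hS
  rcases hμ.eq_or_lt with rfl | hμ'
  · have h := inner_apply_eq_norm_sqrt_sq hT x
    rw [hx] at h
    have h' : ‖S x‖ ^ 2 = 0 := Complex.ofReal_injective (by simpa using h.symm)
    simpa using h'
  -- `y = (S - √μ) x` satisfies `(S + √μ) y = (T - μ) x = 0`
  set y := S x - ((√μ : ℝ) : ℂ) • x with hy
  have hSS : S (S x) = (μ : ℂ) • x := by
    rw [← hx, ← mul_apply_eq_comp, CFC.sqrt_mul_sqrt_self T hT]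
  have hSy : S y = -(((√μ : ℝ) : ℂ) • y) := by
    rw [hy, map_sub, map_smul, hSS, smul_sub, smul_smul, ← Complex.ofReal_mul,
      Real.mul_self_sqrt hμ]
    abel
  have h0 := hS.re_inner_nonneg_right y
  rw [hSy, inner_neg_right, inner_smul_right, inner_self_eq_norm_sq_to_K] at h0
  have h1 : √μ * ‖y‖ ^ 2 ≤ 0 := by
    have h2 : 0 ≤ -(√μ * ‖y‖ ^ 2) := by
      rw [← Complex.ofReal_re (-(√μ * ‖y‖ ^ 2))]
      simpa using h0
    linarith
  have h2 : y = 0 := by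
    have := nonpos_of_mul_nonpos_right h1 (Real.sqrt_pos.2 hμ')
    simpa using le_antisymm this (sq_nonneg _)
  rwa [hy, sub_eq_zero] at h2

/-- The form trace of a positive operator `T` is bounded below by the sum over a finite orthonormal
family of eigenvectors of `T`. -/
theorem sum_le_formTrace (A : E →ₗ.[ℂ] E) (m : ℝ) {T : E →L[ℂ] E} (hT : 0 ≤ T) {ι : Type*}
    {g : ι → E} (hg : Orthonormal ℂ g) {μ : ι → ℝ} (hμ : ∀ i, 0 ≤ μ i)
    (hTg : ∀ i, T (g i) = (μ i : ℂ) • g i) (s : Finset ι) :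
    ∑ i ∈ s, ENNReal.ofReal (μ i) * closedForm A m (g i) ≤ formTrace A m T := by
  refine le_trans (le_of_eq ?_)
    (sum_le_iSup_orthonormal hg s fun x => closedForm A m (CFC.sqrt T x))
  refine Finset.sum_congr rfl fun i _ => ?_
  rw [sqrt_apply_of_eigenvector hT (hμ i) (hTg i), closedForm_smul]
  congr 1
  rw [← ofReal_norm, ← ENNReal.ofReal_pow (norm_nonneg _), Complex.norm_real,
    Real.norm_of_nonneg (Real.sqrt_nonneg _), Real.sq_sqrt (hμ i)]

/-- The form trace of a nonnegative multiple of a finite-rank projection is bounded above by the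
sum over an orthonormal basis of its range. -/
theorem formTrace_smul_familyProj_le {A : E →ₗ.[ℂ] E} {m : ℝ} (hA : A.IsFormalAdjoint A)
    (hpos : ∀ x, 0 ≤ opForm A m x) {ι : Type*} [Fintype ι] {f : ι → E} (hf : Orthonormal ℂ f)
    {c : ℝ} (hc : 0 ≤ c) :
    formTrace A m ((c : ℂ) • familyProj f) ≤ ENNReal.ofReal c * ∑ i, closedForm A m (f i) := by
  have hsqrt : CFC.sqrt ((c : ℂ) • familyProj f) = ((√c : ℝ) : ℂ) • familyProj f := by
    refine CFC.sqrt_unique ?_ ?_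
    · rw [smul_mul_smul_comm, familyProj_mul_self hf, ← Complex.ofReal_mul, Real.mul_self_sqrt hc]
    · rw [ContinuousLinearMap.nonneg_iff_isPositive]
      exact ((ContinuousLinearMap.nonneg_iff_isPositive _).1
        (familyProj_nonneg f)).smul_of_nonneg (by exact_mod_cast Real.sqrt_nonneg c)
  refine iSup₂_le fun w hw => ?_
  rw [hsqrt]
  simp only [smul_apply, familyProj_apply, closedForm_smul, ← Finset.mul_sum]
  have h : ‖((√c : ℝ) : ℂ)‖ₑ ^ 2 = ENNReal.ofReal c := by
    rw [← ofReal_norm, ← ENNReal.ofReal_pow (norm_nonneg _), Complex.norm_real,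
      Real.norm_of_nonneg (Real.sqrt_nonneg _), Real.sq_sqrt hc]
  rw [h]
  gcongr
  exact sum_closedForm_le hA hpos hf hw

theorem isTraceClass_familyProj {ι : Type*} [Fintype ι] {f : ι → E} (hf : Orthonormal ℂ f) :
    IsTraceClass (familyProj f) := by
  rw [IsTraceClass, CFC.abs_of_nonneg _ (familyProj_nonneg f)]
  refine lt_of_le_of_lt (b := ENNReal.ofReal (Fintype.card ι)) ?_ ENNReal.ofReal_lt_top
  refine iSup₂_le fun w hw => ?_
  simp only [inner_familyProj, Complex.ofReal_re]
  rw [← ENNReal.ofReal_sum_of_nonneg fun x _ => Finset.sum_nonneg fun i _ => sq_nonneg _]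
  refine ENNReal.ofReal_le_ofReal ?_
  rw [Finset.sum_comm]
  calc ∑ i, ∑ x ∈ w, ‖inner ℂ (f i) x‖ ^ 2 ≤ ∑ i, ‖f i‖ ^ 2 := by
        refine Finset.sum_le_sum fun i _ => ?_
        have h := hw.sum_inner_products_le (f i) (s := Finset.univ)
        rw [Finset.sum_coe_sort w fun x => ‖inner ℂ x (f i)‖ ^ 2] at h
        simpa only [norm_inner_symm] using h
    _ = Fintype.card ι := by simp [hf.1]

theorem trace_familyProj {ι : Type*} [Fintype ι] {f : ι → E} (hf : Orthonormal ℂ f) :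
    trace (familyProj f) = Fintype.card ι := by
  obtain ⟨b, hb⟩ := (exists_hilbertBasis ℂ E).choose_spec
  have h : HasSum (fun e => ∑ i, inner ℂ (f i) (b e) * inner ℂ (b e) (f i))
      (∑ i, inner ℂ (f i) (f i)) :=
    hasSum_sum fun i _ => b.hasSum_inner_mul_inner (f i) (f i)
  have h1 : ∀ i, inner ℂ (f i) (f i) = 1 := fun i => by
    rw [inner_self_eq_norm_sq_to_K, hf.1]; simp
  rw [trace]
  simp only [h1, Finset.sum_const, Finset.card_univ, nsmul_eq_mul, mul_one] at h
  rw [← h.tsum_eq]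
  refine tsum_congr fun e => ?_
  rw [hb, familyProj_apply, inner_sum]
  simp [inner_smul_right]

theorem IsTraceClass.tsum_lt_top {T : E →L[ℂ] E} (h : IsTraceClass T) (hT : 0 ≤ T) {ι : Type*}
    {g : ι → E} (hg : Orthonormal ℂ g) : ∑' i, ‖CFC.sqrt T (g i)‖ₑ ^ 2 < ⊤ := by
  rw [IsTraceClass, CFC.abs_of_nonneg _ hT] at h
  refine lt_of_le_of_lt ?_ h
  rw [ENNReal.tsum_eq_iSup_sum]
  refine iSup_le fun s => ?_
  refine le_trans (le_of_eq ?_)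
    (sum_le_iSup_orthonormal hg s fun x => ENNReal.ofReal (inner ℂ x (T x)).re)
  refine Finset.sum_congr rfl fun i _ => ?_
  rw [inner_apply_eq_norm_sqrt_sq hT, Complex.ofReal_re, ENNReal.ofReal_pow (norm_nonneg _),
    ofReal_norm]

theorem IsTraceClass.summable {T : E →L[ℂ] E} (h : IsTraceClass T) (hT : 0 ≤ T) {ι : Type*}
    {g : ι → E} (hg : Orthonormal ℂ g) : Summable fun i => ‖CFC.sqrt T (g i)‖ ^ 2 := by
  have h1 := ENNReal.summable_toReal (h.tsum_lt_top hT hg).ne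
  simpa using h1

/-- The trace of a positive trace class operator is the sum of `‖T^{1/2} b i‖²` over any Hilbert
basis. -/
theorem IsTraceClass.hasSum_trace {T : E →L[ℂ] E} (h : IsTraceClass T) (hT : 0 ≤ T) {ι : Type*}
    (b : HilbertBasis ι ℂ E) : HasSum (fun i => ‖CFC.sqrt T (b i)‖ ^ 2) (trace T).re := by
  obtain ⟨e, he⟩ := (exists_hilbertBasis ℂ E).choose_spec
  have hS : (CFC.sqrt T).IsSymmetric :=
    ((ContinuousLinearMap.nonneg_iff_isPositive _).1 (CFC.sqrt_nonneg T)).isSymmetric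
  have h1 : trace T = ((∑' k, ‖CFC.sqrt T (e k)‖ ^ 2 : ℝ) : ℂ) := by
    rw [trace, Complex.ofReal_tsum]
    exact tsum_congr fun k => by rw [he, inner_apply_eq_norm_sqrt_sq hT]
  have hb := h.summable hT b.orthonormal
  have he' := h.summable hT e.orthonormal
  have h2 : ∑' k, ‖CFC.sqrt T (e k)‖ ^ 2 = ∑' i, ‖CFC.sqrt T (b i)‖ ^ 2 := by
    have h3 := tsum_enorm_apply_sq_eq e b hS
    have h4 := congrArg ENNReal.toReal h3
    rw [ENNReal.tsum_toReal_eq (by simp), ENNReal.tsum_toReal_eq (by simp)] at h4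
    simpa using h4
  rw [h1, Complex.ofReal_re, h2]
  exact hb.hasSum

/-- A positive trace class operator is compact, since its root is a Hilbert-Schmidt operator,
hence a limit of operators of finite rank. -/
theorem IsTraceClass.isCompactOperator {T : E →L[ℂ] E} (h : IsTraceClass T) (hT : 0 ≤ T) :
    IsCompactOperator T := by
  obtain ⟨w, e, -⟩ := exists_hilbertBasis ℂ E
  set S := CFC.sqrt T with hSdef
  have hS : S.IsSymmetric :=
    ((ContinuousLinearMap.nonneg_iff_isPositive _).1 (CFC.sqrt_nonneg T)).isSymmetric
  have hsum : Summable fun k => ‖S (e k)‖ ^ 2 := h.summable hT e.orthonormal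
  let F : Finset w → E →L[ℂ] E := fun s => familyProj (fun k : s => e k) * S
  have hbound : ∀ s, ‖S - F s‖ ≤ √(∑' k : {k // k ∉ s}, ‖S (e k)‖ ^ 2) := by
    intro s
    refine ContinuousLinearMap.opNorm_le_bound _ (Real.sqrt_nonneg _) fun x => ?_
    refine Real.le_sqrt_of_sq_le ?_ |>.trans_eq
      (b := √((∑' k : {k // k ∉ s}, ‖S (e k)‖ ^ 2) * ‖x‖ ^ 2)) ?_
    swap
    · rw [Real.sqrt_mul (tsum_nonneg fun k => sq_nonneg _), Real.sqrt_sq (norm_nonneg _)]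
    have hparseval := hasSum_norm_inner_sq e (S x)
    have hon : Orthonormal ℂ (fun k : s => e k) :=
      e.orthonormal.comp (fun k : s => (k : w)) Subtype.val_injective
    have h1 : ‖(S - F s) x‖ ^ 2 = ∑' k : {k // k ∉ s}, ‖inner ℂ (e k) (S x)‖ ^ 2 := by
      have h2 := norm_sub_familyProj_sq hon (S x)
      rw [Finset.sum_coe_sort s fun k => ‖inner ℂ (e k) (S x)‖ ^ 2] at h2
      have h3 := hparseval.summable.sum_add_tsum_subtype_compl s
      rw [hparseval.tsum_eq] at h3
      change ‖S x - familyProj (fun k : s => e k) (S x)‖ ^ 2 = _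
      linarith
    rw [h1, ← tsum_mul_right]
    refine Summable.tsum_le_tsum (fun k => ?_) (hparseval.summable.subtype _)
      ((hsum.subtype _).mul_right _)
    rw [← hS.apply_clm, ← mul_pow]
    exact pow_le_pow_left₀ (norm_nonneg _) (norm_inner_le_norm _ _) 2
  have hlim : Tendsto F atTop (𝓝 S) := by
    rw [tendsto_iff_norm_sub_tendsto_zero]
    have h0 := (tendsto_tsum_compl_atTop_zero fun k => ‖S (e k)‖ ^ 2).sqrt
    rw [Real.sqrt_zero] at h0
    refine squeeze_zero (fun _ => norm_nonneg _) (fun s => ?_) h0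
    rw [norm_sub_rev]
    exact hbound s
  have hcompact : IsCompactOperator S :=
    isCompactOperator_of_tendsto hlim (Eventually.of_forall fun s =>
      (isCompactOperator_familyProj _).comp_clm S)
  have h1 := hcompact.clm_comp S
  have h2 : (S : E → E) ∘ S = T := by
    rw [← CFC.sqrt_mul_sqrt_self T hT]
    rfl
  rwa [h2] at h1

/-- A positive trace class operator has a Hilbert basis of eigenvectors. -/
theorem IsTraceClass.exists_eigenbasis {E : Type u} [NormedAddCommGroup E] [InnerProductSpace ℂ E]
    [CompleteSpace E] {T : E →L[ℂ] E} (h : IsTraceClass T) (hT : 0 ≤ T) :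
    ∃ (ι : Type u) (b : HilbertBasis ι ℂ E) (μ : ι → ℝ),
      ∀ i, 0 ≤ μ i ∧ T (b i) = (μ i : ℂ) • b i := by
  have hpos := (ContinuousLinearMap.nonneg_iff_isPositive _).1 hT
  have hbot := ContinuousLinearMap.orthogonalComplement_iSup_eigenspaces_eq_bot
    (h.isCompactOperator hT) hpos.isSymmetric
  have hclosed : ∀ μ : ℂ, IsClosed
      (Module.End.eigenspace (T : E →ₗ[ℂ] E) μ : Set E) := by
    intro μ
    have : (Module.End.eigenspace (T : E →ₗ[ℂ] E) μ : Set E) = {x | T x = μ • x} := by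
      ext x
      simp
    rw [this]
    exact isClosed_eq T.continuous (continuous_const_smul μ)
  have hcomplete : ∀ μ : ℂ, CompleteSpace (Module.End.eigenspace (T : E →ₗ[ℂ] E) μ) :=
    fun μ => (hclosed μ).completeSpace_coe
  choose w e _ using fun μ : ℂ => exists_hilbertBasis ℂ (Module.End.eigenspace (T : E →ₗ[ℂ] E) μ)
  have hon : Orthonormal ℂ (fun a : Σ μ, w μ => ((e a.1 a.2 : _) : E)) :=
    hpos.isSymmetric.orthogonalFamily_eigenspaces.orthonormal_sigma_orthonormal
      fun μ => (e μ).orthonormal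
  have hspan : (Submodule.span ℂ (Set.range (fun a : Σ μ, w μ => ((e a.1 a.2 : _) : E))))ᗮ = ⊥ := by
    rw [eq_bot_iff, ← hbot]
    refine fun x hx => ?_
    rw [Submodule.mem_orthogonal] at hx ⊢
    intro y hy
    induction hy using Submodule.iSup_induction' with
    | mem μ y hy =>
      have h1 := (e μ).hasSum_inner_mul_inner
        ⟨y, hy⟩ ((Module.End.eigenspace (T : E →ₗ[ℂ] E) μ).orthogonalProjectionOnto x)
      have h2 : ∀ i, inner ℂ (e μ i)
          ((Module.End.eigenspace (T : E →ₗ[ℂ] E) μ).orthogonalProjectionOnto x) = 0 := by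
        intro i
        rw [Submodule.inner_orthogonalProjectionOnto_eq_of_mem_left]
        exact hx _ (Submodule.subset_span ⟨⟨μ, i⟩, rfl⟩)
      simp only [h2, mul_zero] at h1
      have h3 := h1.unique hasSum_zero
      rwa [Submodule.inner_orthogonalProjectionOnto_eq_of_mem_left] at h3
    | zero => simp
    | add y z _ _ hy hz => rw [inner_add_left, hy, hz, add_zero]
  refine ⟨_, HilbertBasis.mkOfOrthogonalEqBot hon hspan, fun a => a.1.re, fun a => ?_⟩
  rw [HilbertBasis.coe_mkOfOrthogonalEqBot]
  have hev : T (e a.1 a.2 : E) = a.1 • (e a.1 a.2 : E) :=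
    Module.End.mem_eigenspace_iff.1 (e a.1 a.2).2
  have hval : inner ℂ (e a.1 a.2 : E) (T (e a.1 a.2 : E)) = a.1 := by
    rw [hev, inner_smul_right, inner_self_eq_norm_sq_to_K, hon.1 a]
    simp
  rw [inner_apply_eq_norm_sqrt_sq hT] at hval
  have hre : ((a.1.re : ℝ) : ℂ) = a.1 := by
    rw [← hval, Complex.ofReal_re]
  refine ⟨?_, by rw [hre]; exact hev⟩
  change 0 ≤ a.1.re
  rw [← hval, Complex.ofReal_re]
  exact sq_nonneg _

end Trace

/-! ### The two-particle space -/

/-- A symmetric double sum with vanishing diagonal is twice the sum over ordered pairs `i < j`. -/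
theorem sum_sum_eq_two_nsmul_sum_lt {ι M : Type*} [Fintype ι] [LinearOrder ι] [AddCommMonoid M]
    (F : ι → ι → M) (hF : ∀ i j, F i j = F j i) (hF0 : ∀ i, F i i = 0) :
    ∑ i, ∑ j, F i j = 2 • ∑ p : {p : ι × ι // p.1 < p.2}, F p.1.1 p.1.2 := by
  have h1 : ∀ i j, F i j = (if i < j then F i j else 0) + (if j < i then F j i else 0) := by
    intro i j
    rcases lt_trichotomy i j with h | rfl | h
    · simp [h, h.not_gt]
    · simp [hF0]
    · simp [h, h.not_gt, hF i j]
  have h2 : ∑ p : {p : ι × ι // p.1 < p.2}, F p.1.1 p.1.2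
      = ∑ i, ∑ j, (if i < j then F i j else 0) := by
    rw [← Fintype.sum_prod_type' (f := fun i j => if i < j then F i j else 0),
      ← Finset.sum_filter]
    exact (Finset.sum_subtype _ (by simp) fun p : ι × ι => F p.1 p.2).symm
  rw [h2, two_nsmul]
  conv_lhs => enter [2, i, 2, j]; rw [h1 i j]
  simp only [Finset.sum_add_distrib]
  congr 1
  exact Finset.sum_comm

/-- If the self-adjoint involution `J` commutes with the self-adjoint operator `R`, then
`(1 - J) R² = ½ K* K` with `K = R (1 - J)`. -/
theorem one_sub_mul_mul_self_nonneg {E : Type*} [NormedAddCommGroup E] [InnerProductSpace ℂ E]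
    [CompleteSpace E] {J R : E →L[ℂ] E} (hJ : IsSelfAdjoint J) (hR : IsSelfAdjoint R)
    (hJJ : J * J = 1) (hJR : J * R = R * J) : 0 ≤ (1 - J) * (R * R) := by
  have hstar : star (R * (1 - J)) = (1 - J) * R := by
    rw [star_mul, hR.star_eq, ((IsSelfAdjoint.one _).sub hJ).star_eq]
  have hcomm : R * (1 - J) = (1 - J) * R := by
    rw [mul_sub, sub_mul, hJR, mul_one, one_mul]
  have hsq : (1 - J) * (1 - J) = (2 : ℂ) • (1 - J) := by
    rw [mul_sub, mul_one, sub_mul, one_mul, hJJ, two_smul]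
    abel
  have hKK : star (R * (1 - J)) * (R * (1 - J)) = (2 : ℂ) • ((1 - J) * (R * R)) := by
    rw [hstar, mul_assoc, ← mul_assoc R, mul_assoc R R, hcomm, ← mul_assoc R, hcomm, mul_assoc,
      ← mul_assoc, hsq, smul_mul_assoc]
  have h : (1 - J) * (R * R) = ((2⁻¹ : ℝ) : ℂ) • (star (R * (1 - J)) * (R * (1 - J))) := by
    rw [hKK, smul_smul]
    norm_num
  rw [h, ContinuousLinearMap.nonneg_iff_isPositive]
  exact (ContinuousLinearMap.isPositive_adjoint_comp_self (R * (1 - J))).smul_of_nonneg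
    (by exact_mod_cast (by norm_num : (0 : ℝ) ≤ 2⁻¹))

section TwoParticle

variable {H : Type*} [NormedAddCommGroup H] [InnerProductSpace ℂ H]

/-- A continuous linear map on the two-particle space is determined by its values on pure
tensors. -/
theorem twoParticle_ext {F : Type*} [NormedAddCommGroup F] [NormedSpace ℂ F]
    {S T : TwoParticle H →L[ℂ] F}
    (h : ∀ a b : H, S ((a ⊗ₜ[ℂ] b : H ⊗[ℂ] H) : TwoParticle H)
      = T ((a ⊗ₜ[ℂ] b : H ⊗[ℂ] H) : TwoParticle H)) : S = T := by
  ext x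
  induction x using UniformSpace.Completion.induction_on with
  | hp => exact isClosed_eq S.continuous T.continuous
  | ih x =>
    induction x using TensorProduct.induction_on with
    | zero => rw [UniformSpace.Completion.coe_zero, map_zero, map_zero]
    | tmul a b => exact h a b
    | add x y hx hy => rw [UniformSpace.Completion.coe_add, map_add, map_add, hx, hy]

theorem twoParticle_isSymmetric {S : TwoParticle H →L[ℂ] TwoParticle H}
    (h : ∀ a b c d : H,
      inner ℂ (S ((a ⊗ₜ[ℂ] b : H ⊗[ℂ] H) : TwoParticle H))
        ((c ⊗ₜ[ℂ] d : H ⊗[ℂ] H) : TwoParticle H)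
      = inner ℂ ((a ⊗ₜ[ℂ] b : H ⊗[ℂ] H) : TwoParticle H)
        (S ((c ⊗ₜ[ℂ] d : H ⊗[ℂ] H) : TwoParticle H))) : S.IsSymmetric := by
  have h1 : ∀ (a b : H) (y : TwoParticle H),
      inner ℂ (S ((a ⊗ₜ[ℂ] b : H ⊗[ℂ] H) : TwoParticle H)) y
        = inner ℂ ((a ⊗ₜ[ℂ] b : H ⊗[ℂ] H) : TwoParticle H) (S y) := by
    intro a b y
    have h2 : innerSL ℂ (S ((a ⊗ₜ[ℂ] b : H ⊗[ℂ] H) : TwoParticle H))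
        = (innerSL ℂ ((a ⊗ₜ[ℂ] b : H ⊗[ℂ] H) : TwoParticle H)) ∘L S :=
      twoParticle_ext fun c d => h a b c d
    exact congrArg (fun L : TwoParticle H →L[ℂ] ℂ => L y) h2
  have h3 : S.adjoint = S := by
    refine twoParticle_ext fun a b => ext_inner_right ℂ fun y => ?_
    rw [ContinuousLinearMap.adjoint_inner_left, h1]
  intro x y
  change inner ℂ (S x) y = inner ℂ x (S y)
  rw [← ContinuousLinearMap.adjoint_inner_left, h3]

theorem exchange_tmul (a b : H) :
    exchange H ((a ⊗ₜ[ℂ] b : H ⊗[ℂ] H) : TwoParticle H)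
      = ((b ⊗ₜ[ℂ] a : H ⊗[ℂ] H) : TwoParticle H) := by
  rw [exchange, ContinuousLinearMap.completion_apply_coe]
  rfl

theorem tensorSquare_tmul (γ : H →L[ℂ] H) (a b : H) :
    tensorSquare γ ((a ⊗ₜ[ℂ] b : H ⊗[ℂ] H) : TwoParticle H)
      = ((γ a ⊗ₜ[ℂ] γ b : H ⊗[ℂ] H) : TwoParticle H) := by
  rw [tensorSquare, ContinuousLinearMap.completion_apply_coe, TensorProduct.mapL_tmul]

theorem exchange_mul_self : exchange H * exchange H = 1 :=
  twoParticle_ext fun a b => by simp [exchange_tmul]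

theorem exchange_mul_tensorSquare (γ : H →L[ℂ] H) :
    exchange H * tensorSquare γ = tensorSquare γ * exchange H :=
  twoParticle_ext fun a b => by simp [exchange_tmul, tensorSquare_tmul]

theorem tensorSquare_mul (γ δ : H →L[ℂ] H) :
    tensorSquare γ * tensorSquare δ = tensorSquare (γ * δ) :=
  twoParticle_ext fun a b => by simp [tensorSquare_tmul]

theorem isSelfAdjoint_exchange : IsSelfAdjoint (exchange H) :=
  (twoParticle_isSymmetric fun a b c d => by
    simp [exchange_tmul, mul_comm]).isSelfAdjoint

theorem isSelfAdjoint_tensorSquare [CompleteSpace H] {γ : H →L[ℂ] H} (hγ : IsSelfAdjoint γ) :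
    IsSelfAdjoint (tensorSquare γ) :=
  (twoParticle_isSymmetric fun a b c d => by
    simp [tensorSquare_tmul, hγ.isSymmetric.apply_clm]).isSelfAdjoint

theorem exchange_tensorSquare_nonneg [CompleteSpace H] {γ : H →L[ℂ] H} (hγ : 0 ≤ γ) :
    0 ≤ (1 - exchange H) * tensorSquare γ := by
  have hsa : IsSelfAdjoint (CFC.sqrt γ) :=
    ((ContinuousLinearMap.nonneg_iff_isPositive _).1 (CFC.sqrt_nonneg γ)).isSelfAdjoint
  have h := one_sub_mul_mul_self_nonneg isSelfAdjoint_exchange (isSelfAdjoint_tensorSquare hsa)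
    exchange_mul_self (exchange_mul_tensorSquare (CFC.sqrt γ))
  rwa [tensorSquare_mul, CFC.sqrt_mul_sqrt_self γ hγ] at h

/-! ### Wedge products -/

theorem wedge_self (a : H) : wedge a a = 0 := by simp [wedge]

theorem wedge_swap (a b : H) : wedge b a = -wedge a b := by
  rw [wedge, wedge, ← smul_neg, ← UniformSpace.Completion.coe_neg, neg_sub]

theorem wedge_add_left (a a' b : H) : wedge (a + a') b = wedge a b + wedge a' b := by
  rw [wedge, wedge, wedge, ← smul_add, ← UniformSpace.Completion.coe_add, TensorProduct.add_tmul,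
    TensorProduct.tmul_add, add_sub_add_comm]

theorem wedge_smul_left (c : ℂ) (a b : H) : wedge (c • a) b = c • wedge a b := by
  have h : (c • a) ⊗ₜ[ℂ] b - b ⊗ₜ[ℂ] (c • a) = c • (a ⊗ₜ[ℂ] b - b ⊗ₜ[ℂ] a) := by
    rw [TensorProduct.smul_tmul, TensorProduct.tmul_smul, TensorProduct.tmul_smul, smul_sub]
  rw [wedge, wedge, h, UniformSpace.Completion.coe_smul, smul_comm]

/-- The wedge product as a bilinear map. -/
noncomputable def wedgeBilin : H →ₗ[ℂ] H →ₗ[ℂ] TwoParticle H :=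
  LinearMap.mk₂ ℂ wedge wedge_add_left wedge_smul_left
    (fun a b b' => by
      rw [wedge_swap, wedge_add_left, neg_add, ← wedge_swap, ← wedge_swap])
    (fun c a b => by rw [wedge_swap, wedge_smul_left, ← smul_neg, ← wedge_swap])

theorem wedge_smul_smul (c d : ℂ) (a b : H) : wedge (c • a) (d • b) = (c * d) • wedge a b := by
  change wedgeBilin (c • a) (d • b) = (c * d) • wedgeBilin a b
  rw [map_smul, map_smul, LinearMap.smul_apply, smul_smul, mul_comm]

theorem wedge_sum_sum {ι : Type*} [Fintype ι] (c d : ι → ℂ) (f : ι → H) :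
    wedge (∑ i, c i • f i) (∑ j, d j • f j) = ∑ i, ∑ j, (c i * d j) • wedge (f i) (f j) := by
  simp only [← wedge_smul_smul]
  change wedgeBilin _ _ = ∑ i, ∑ j, wedgeBilin (c i • f i) (d j • f j)
  simp only [map_sum, LinearMap.sum_apply]
  exact Finset.sum_comm

theorem coe_tmul_sub_tmul (a b : H) :
    ((a ⊗ₜ[ℂ] b : H ⊗[ℂ] H) : TwoParticle H) - ((b ⊗ₜ[ℂ] a : H ⊗[ℂ] H) : TwoParticle H)
      = ((√2 : ℝ) : ℂ) • wedge a b := by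
  rw [wedge, smul_inv_smul₀ (by simp), UniformSpace.Completion.coe_sub]

theorem inner_wedge_tmul (a b c d : H) :
    inner ℂ (wedge a b) ((c ⊗ₜ[ℂ] d : H ⊗[ℂ] H) : TwoParticle H)
      = ((√2 : ℝ) : ℂ)⁻¹ * (inner ℂ a c * inner ℂ b d - inner ℂ b c * inner ℂ a d) := by
  rw [wedge, inner_smul_left, UniformSpace.Completion.inner_coe, inner_sub_left,
    TensorProduct.inner_tmul, TensorProduct.inner_tmul, map_inv₀, Complex.conj_ofReal]

theorem inner_wedge_wedge (a b c d : H) :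
    inner ℂ (wedge a b) (wedge c d) = inner ℂ a c * inner ℂ b d - inner ℂ b c * inner ℂ a d := by
  have h2 : ((√2 : ℝ) : ℂ)⁻¹ * ((√2 : ℝ) : ℂ)⁻¹ = 2⁻¹ := by
    rw [← mul_inv, ← Complex.ofReal_mul, Real.mul_self_sqrt (by norm_num)]
    norm_num
  rw [wedge.eq_1 c d, inner_smul_right, UniformSpace.Completion.coe_sub, inner_sub_right,
    inner_wedge_tmul, inner_wedge_tmul]
  linear_combination (2 * (inner ℂ a c * inner ℂ b d - inner ℂ b c * inner ℂ a d)) * h2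

theorem orthonormal_wedge {ι : Type*} [LinearOrder ι] {f : ι → H} (hf : Orthonormal ℂ f) :
    Orthonormal ℂ (fun p : {p : ι × ι // p.1 < p.2} => wedge (f p.1.1) (f p.1.2)) := by
  rw [orthonormal_iff_ite] at hf ⊢
  rintro ⟨⟨i, j⟩, hij⟩ ⟨⟨k, l⟩, hkl⟩
  simp only at hij hkl
  simp only [inner_wedge_wedge, hf, Subtype.mk.injEq, Prod.mk.injEq]
  by_cases h1 : i = k
  · subst h1
    by_cases h2 : j = l
    · subst h2; simp [hij.ne']
    · simp [h2, hij.ne']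
  · by_cases h2 : j = k
    · subst h2
      simp [h1, (hij.trans hkl).ne]
    · simp [h1, h2]

theorem exchange_tensorSquare_tmul (γ : H →L[ℂ] H) (a b : H) :
    ((1 - exchange H) * tensorSquare γ) ((a ⊗ₜ[ℂ] b : H ⊗[ℂ] H) : TwoParticle H)
      = ((√2 : ℝ) : ℂ) • wedge (γ a) (γ b) := by
  rw [mul_apply_eq_comp, tensorSquare_tmul, ← coe_tmul_sub_tmul]
  refine (sub_apply _ _ _).trans ?_
  rw [exchange_tmul, one_apply_eq_self]

theorem exchange_tensorSquare_wedge (γ : H →L[ℂ] H) (a b : H) :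
    ((1 - exchange H) * tensorSquare γ) (wedge a b) = (2 : ℂ) • wedge (γ a) (γ b) := by
  rw [wedge.eq_1 a b, map_smul, UniformSpace.Completion.coe_sub, map_sub,
    exchange_tensorSquare_tmul, exchange_tensorSquare_tmul, wedge_swap (γ a) (γ b), smul_neg,
    sub_neg_eq_add, smul_add, inv_smul_smul₀ (by simp), two_smul]

/-- If `γ` is the projection onto the span of an orthonormal family `f`, then `(1 - Ex) (γ ⊗ γ)` is
twice the projection onto the span of the vectors `f i ∧ f j`. -/
theorem exchange_tensorSquare_familyProj {ι : Type*} [Fintype ι] [LinearOrder ι] (f : ι → H) :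
    (1 - exchange H) * tensorSquare (familyProj f)
      = ((2 : ℝ) : ℂ) • familyProj
          (fun p : {p : ι × ι // p.1 < p.2} => wedge (f p.1.1) (f p.1.2)) := by
  refine twoParticle_ext fun a b => ?_
  rw [exchange_tensorSquare_tmul, smul_apply, familyProj_apply, familyProj_apply,
    familyProj_apply, wedge_sum_sum]
  have h := sum_sum_eq_two_nsmul_sum_lt
    (fun i j => inner ℂ (wedge (f i) (f j)) ((a ⊗ₜ[ℂ] b : H ⊗[ℂ] H) : TwoParticle H)
      • wedge (f i) (f j))
    (fun i j => by rw [wedge_swap (f i) (f j), inner_neg_left, neg_smul_neg])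
    (fun i => by rw [wedge_self, smul_zero])
  rw [← Nat.cast_smul_eq_nsmul ℂ] at h
  push_cast at h ⊢
  rw [← h]
  have hswap : ∑ i, ∑ j, (inner ℂ (f j) a * inner ℂ (f i) b) • wedge (f i) (f j)
      = -∑ i, ∑ j, (inner ℂ (f i) a * inner ℂ (f j) b) • wedge (f i) (f j) := by
    rw [Finset.sum_comm]
    simp only [← Finset.sum_neg_distrib, ← smul_neg, ← wedge_swap]
  have hrow : ∀ i j, inner ℂ (wedge (f i) (f j)) ((a ⊗ₜ[ℂ] b : H ⊗[ℂ] H) : TwoParticle H)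
      • wedge (f i) (f j) = ((√2 : ℝ) : ℂ)⁻¹ •
        ((inner ℂ (f i) a * inner ℂ (f j) b) • wedge (f i) (f j)
          - (inner ℂ (f j) a * inner ℂ (f i) b) • wedge (f i) (f j)) := fun i j => by
    rw [inner_wedge_tmul, mul_smul, sub_smul]
  simp only [hrow, ← Finset.smul_sum, Finset.sum_sub_distrib]
  rw [hswap, sub_neg_eq_add, ← two_smul ℂ, smul_smul]
  congr 1
  have h2 : ((√2 : ℝ) : ℂ) * ((√2 : ℝ) : ℂ) = 2 := by
    rw [← Complex.ofReal_mul, Real.mul_self_sqrt (by norm_num)]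
    norm_num
  have h0 : ((√2 : ℝ) : ℂ) ≠ 0 := by simp
  field_simp
  linear_combination h2

end TwoParticle

/-! ### The variational principle -/

theorem coe_sub_add_coe_eq (a b : ℝ≥0∞) (c : ℝ) :
    (a : EReal) - (c : EReal) + (b : EReal) = ((a + b : ℝ≥0∞) : EReal) - (c : EReal) := by
  rw [EReal.coe_ennreal_add, sub_eq_add_neg, sub_eq_add_neg, add_right_comm]

section Variational

universe u

variable {H : Type u} [NormedAddCommGroup H] [InnerProductSpace ℂ H]
  {h : H →ₗ.[ℂ] H} {m : ℝ} {V : TwoParticle H →ₗ.[ℂ] TwoParticle H}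

theorem closedForm_wedge_swap (a b : H) :
    closedForm V 0 (wedge b a) = closedForm V 0 (wedge a b) := by
  rw [wedge_swap, closedForm_neg]

theorem closedForm_wedge_self (a : H) : closedForm V 0 (wedge a a) = 0 := by
  rw [wedge_self, closedForm_zero]

variable [CompleteSpace H]

/-- The functional of the projection onto the span of the orbitals `f` is bounded by the energy of
their Slater determinant. -/
theorem energy_familyProj_le (hA : h.IsFormalAdjoint h) (hpos : ∀ x, 0 ≤ opForm h m x)
    (hV : V.IsFormalAdjoint V) (hVpos : ∀ ψ, 0 ≤ opForm V 0 ψ) {N : ℕ} {f : Fin N → H}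
    (hf : Orthonormal ℂ f) : energy h m V (familyProj f) ≤ slaterEnergy h m V f := by
  have h1 : formTrace h m (familyProj f) ≤ ∑ i, closedForm h m (f i) := by
    simpa using formTrace_smul_familyProj_le hA hpos hf zero_le_one
  have h2 : formTrace V 0 ((1 - exchange H) * tensorSquare (familyProj f))
      ≤ ∑ i, ∑ j, closedForm V 0 (wedge (f i) (f j)) := by
    rw [exchange_tensorSquare_familyProj,
      sum_sum_eq_two_nsmul_sum_lt (fun i j => closedForm V 0 (wedge (f i) (f j)))
        (fun i j => closedForm_wedge_swap _ _) (fun i => closedForm_wedge_self _)]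
    refine (formTrace_smul_familyProj_le hV hVpos (orthonormal_wedge hf) zero_le_two).trans ?_
    simp
  have h3 : (trace (familyProj f)).re = N := by simp [trace_familyProj hf]
  rw [energy, slaterEnergy, h3]
  refine add_le_add (EReal.sub_le_sub (EReal.coe_ennreal_le_coe_ennreal_iff.2 h1) le_rfl)
    (EReal.coe_ennreal_le_coe_ennreal_iff.2 ?_)
  gcongr

/-- The interaction term of the functional is bounded below by the interaction energy of the
eigenvectors of `γ`, weighted with products of their eigenvalues. -/
theorem sum_closedForm_wedge_le {ι : Type*} [Fintype ι] [LinearOrder ι] {γ : H →L[ℂ] H}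
    (hγ : 0 ≤ γ) {g : ι → H} (hg : Orthonormal ℂ g) {μ : ι → ℝ} (hμ : ∀ i, 0 ≤ μ i)
    (hγg : ∀ i, γ (g i) = (μ i : ℂ) • g i) :
    ∑ i, ∑ j, ENNReal.ofReal (μ i * μ j) * closedForm V 0 (wedge (g i) (g j))
      ≤ formTrace V 0 ((1 - exchange H) * tensorSquare γ) := by
  rw [sum_sum_eq_two_nsmul_sum_lt
    (fun i j => ENNReal.ofReal (μ i * μ j) * closedForm V 0 (wedge (g i) (g j)))
    (fun i j => by rw [closedForm_wedge_swap, mul_comm (μ i)])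
    (fun i => by rw [closedForm_wedge_self, mul_zero])]
  refine le_trans (le_of_eq ?_) (sum_le_formTrace V 0 (exchange_tensorSquare_nonneg hγ)
    (orthonormal_wedge hg) (μ := fun p => 2 * (μ p.1.1 * μ p.1.2))
    (fun p => mul_nonneg zero_le_two (mul_nonneg (hμ _) (hμ _))) (fun p => ?_) Finset.univ)
  · rw [nsmul_eq_mul, Finset.mul_sum]
    refine Finset.sum_congr rfl fun p _ => ?_
    rw [ENNReal.ofReal_mul zero_le_two, mul_assoc]
    simp
  · rw [exchange_tensorSquare_wedge, hγg, hγg, wedge_smul_smul, smul_smul]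
    push_cast
    rfl

/-- The energy of a density matrix is bounded below by energies of Slater determinants, namely of
`N` of its eigenvectors each. -/
theorem exists_slater_le {γ : H →L[ℂ] H} (hγ : 0 ≤ γ) (hγ1 : γ ≤ 1) (htc : IsTraceClass γ) {N : ℕ}
    (hN : trace γ = N)
    (hX : formTrace h m γ + 2⁻¹ * formTrace V 0 ((1 - exchange H) * tensorSquare γ) ≠ ⊤)
    {δ : ℝ} (hδ : 0 < δ) :
    ∃ f : Fin N → H, Orthonormal ℂ f ∧
      ∑ i, closedForm h m (f i) + 2⁻¹ * ∑ i, ∑ j, closedForm V 0 (wedge (f i) (f j))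
        ≤ formTrace h m γ + 2⁻¹ * formTrace V 0 ((1 - exchange H) * tensorSquare γ)
          + ENNReal.ofReal δ := by
  obtain ⟨ι, b, μ, hb⟩ := htc.exists_eigenbasis hγ
  have hinner : ∀ i, inner ℂ (b i) (γ (b i)) = (μ i : ℂ) := fun i => by
    rw [(hb i).2, inner_smul_right, inner_self_eq_norm_sq_to_K, b.orthonormal.1 i]
    simp
  have hμ1 : ∀ i, μ i ≤ 1 := by
    intro i
    have h1 := ((ContinuousLinearMap.le_def _ _).1 hγ1).re_inner_nonneg_right (b i)
    rw [sub_apply, inner_sub_right, hinner, one_apply_eq_self,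
      inner_self_eq_norm_sq_to_K, b.orthonormal.1 i] at h1
    simpa using h1
  have hsum : HasSum μ N := by
    have h1 := htc.hasSum_trace hγ b
    rw [hN, Complex.natCast_re] at h1
    convert h1 using 1
    funext i
    have h2 := inner_apply_eq_norm_sqrt_sq hγ (b i)
    rw [hinner] at h2
    exact Complex.ofReal_injective h2
  obtain ⟨S, hcard, hS⟩ := exists_rounding (a := fun i => closedForm h m (b i))
    (b := fun i j => closedForm V 0 (wedge (b i) (b j)))
    (fun i => closedForm_wedge_self _) (fun i j => closedForm_wedge_swap _ _)
    (fun i => (hb i).1) hμ1 hsum hX (fun s => by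
      let : LinearOrder s := LinearOrder.lift' s.equivFin s.equivFin.injective
      have h1 := sum_closedForm_wedge_le (V := V) hγ (g := fun i : s => b i)
        (b.orthonormal.comp (fun i : s => (i : ι)) Subtype.val_injective)
        (μ := fun i : s => μ i) (fun i => (hb i).1) (fun i => (hb i).2)
      rw [← Finset.sum_coe_sort s fun i => ∑ j ∈ s, ENNReal.ofReal (μ i * μ j)
        * closedForm V 0 (wedge (b i) (b j))]
      simp only [← Finset.sum_coe_sort s fun j => ENNReal.ofReal (μ _ * μ j)
        * closedForm V 0 (wedge (b _) (b j))]
      gcongr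
      exact sum_le_formTrace h m hγ b.orthonormal (fun i => (hb i).1) (fun i => (hb i).2) s) hδ
  let e : Fin N ≃ S := (S.equivFinOfCardEq hcard).symm
  refine ⟨fun k => b (e k),
    b.orthonormal.comp (fun k => (e k : ι)) (Subtype.val_injective.comp e.injective), ?_⟩
  have hre : ∀ F : ι → ℝ≥0∞, ∑ k, F (e k) = ∑ i ∈ S, F i := fun F => by
    rw [← Finset.sum_coe_sort S F]
    exact e.sum_comp fun i : S => F i
  have hre₂ : ∑ k, ∑ l, closedForm V 0 (wedge (b (e k)) (b (e l)))
      = ∑ i ∈ S, ∑ j ∈ S, closedForm V 0 (wedge (b i) (b j)) := by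
    rw [← hre fun i => ∑ j ∈ S, closedForm V 0 (wedge (b i) (b j))]
    exact Finset.sum_congr rfl fun k _ => hre fun j => closedForm V 0 (wedge (b (e k)) (b j))
  rw [hre fun i => closedForm h m (b i), hre₂]
  exact hS

theorem groundStateEnergy_le_energy {γ : H →L[ℂ] H} (hγ : 0 ≤ γ) (hγ1 : γ ≤ 1)
    (htc : IsTraceClass γ) {N : ℕ} (hN : trace γ = N) :
    groundStateEnergy h m V N ≤ energy h m V γ := by
  rw [energy, hN, Complex.natCast_re, coe_sub_add_coe_eq]
  set X := formTrace h m γ + 2⁻¹ * formTrace V 0 ((1 - exchange H) * tensorSquare γ) with hXdef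
  by_cases hX : X = ⊤
  · rw [hX, EReal.coe_ennreal_top, EReal.top_sub_coe]
    exact le_top
  have hXreal : (X : EReal) = ((X.toReal : ℝ) : EReal) := by
    conv_lhs => rw [← ENNReal.ofReal_toReal hX]
    rw [EReal.coe_ennreal_ofReal, max_eq_left ENNReal.toReal_nonneg]
  rw [hXreal, ← EReal.coe_sub, ← EReal.le_of_forall_lt_iff_le]
  intro z hz
  have hδ : 0 < z - (X.toReal - m * N) := sub_pos.2 (EReal.coe_lt_coe_iff.1 hz)
  obtain ⟨f, hf, hle⟩ := exists_slater_le hγ hγ1 htc hN hX hδ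
  refine le_trans (sInf_le (Set.mem_image_of_mem _ hf)) ?_
  rw [slaterEnergy, coe_sub_add_coe_eq]
  refine (EReal.sub_le_sub (EReal.coe_ennreal_le_coe_ennreal_iff.2 hle) le_rfl).trans
    (le_of_eq ?_)
  rw [EReal.coe_ennreal_add, ← hXdef, hXreal, EReal.coe_ennreal_ofReal, max_eq_left hδ.le,
    ← EReal.coe_add, ← EReal.coe_sub]
  congr 1
  ring

end Variational

end HartreeFock

/-- Lieb's variational principle. -/
theorem theorem3p3 {H : Type*} [NormedAddCommGroup H] [InnerProductSpace ℂ H] [CompleteSpace H]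
    [TopologicalSpace.SeparableSpace H]
    -- the one-particle operator: densely defined, symmetric, and `h + m ≥ 0`
    (h : H →ₗ.[ℂ] H) (h_dense : Dense (h.domain : Set H)) (h_symm : h.IsFormalAdjoint h)
    (m : ℝ) (h_semibounded : ∀ x : h.domain, -m * ‖(x : H)‖ ^ 2 ≤ (inner ℂ (x : H) (h x)).re)
    -- the pair interaction: densely defined, symmetric, and `V ≥ 0`
    (V : HartreeFock.TwoParticle H →ₗ.[ℂ] HartreeFock.TwoParticle H)
    (V_dense : Dense (V.domain : Set (HartreeFock.TwoParticle H)))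
    (V_symm : V.IsFormalAdjoint V)
    (V_nonneg : ∀ ψ : V.domain, 0 ≤ (inner ℂ (ψ : HartreeFock.TwoParticle H) (V ψ)).re)
    (N : ℕ) (hN : 2 ≤ N) :
    HartreeFock.projectionEnergy h m V N = HartreeFock.relaxedEnergy h m V N ∧
      HartreeFock.groundStateEnergy h m V N = HartreeFock.relaxedEnergy h m V N := by
  have hpos : ∀ x, 0 ≤ HartreeFock.opForm h m x := fun x => by
    rw [HartreeFock.opForm]
    linarith [h_semibounded x]
  have hVpos : ∀ ψ, 0 ≤ HartreeFock.opForm V 0 ψ := fun ψ => by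
    rw [HartreeFock.opForm, zero_mul, add_zero]
    exact V_nonneg ψ
  have h1 : HartreeFock.relaxedEnergy h m V N ≤ HartreeFock.projectionEnergy h m V N := by
    refine sInf_le_sInf (Set.image_mono ?_)
    rintro γ ⟨hsa, htc, htr, hid⟩
    have hproj : IsStarProjection γ := ⟨hid.symm, hsa⟩
    exact ⟨htc, htr, hproj.nonneg, hproj.le_one⟩
  have h2 : HartreeFock.projectionEnergy h m V N ≤ HartreeFock.groundStateEnergy h m V N := by
    refine le_sInf ?_
    rintro _ ⟨f, hf, rfl⟩
    refine le_trans (sInf_le ⟨HartreeFock.familyProj f, ⟨?_, ?_, ?_, ?_⟩, rfl⟩)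
      (HartreeFock.energy_familyProj_le h_symm hpos V_symm hVpos hf)
    · exact ((ContinuousLinearMap.nonneg_iff_isPositive _).1
        (HartreeFock.familyProj_nonneg f)).isSelfAdjoint
    · exact HartreeFock.isTraceClass_familyProj hf
    · simp [HartreeFock.trace_familyProj hf]
    · exact (HartreeFock.familyProj_mul_self hf).symm
  have h3 : HartreeFock.groundStateEnergy h m V N ≤ HartreeFock.relaxedEnergy h m V N := by
    refine le_sInf ?_
    rintro _ ⟨γ, ⟨htc, htr, hγ, hγ1⟩, rfl⟩
    exact HartreeFock.groundStateEnergy_le_energy hγ hγ1 htc htr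
  exact ⟨le_antisymm (h2.trans h3) h1, le_antisymm h3 (h1.trans h2)⟩
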